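/- Let $m,n,k\ge 0$ be integers. Write $\varepsilon\in\mathbb R^m$ for a parameter and $x=(q_0,q,p_0,p)\in\mathbb R^{2(n+1)}$, $q=(q_1,\dots,q_n)$, $p=(p_1,\dots,p_n)$, for canonical coordinates. Let $H^\varepsilon(x)$ be a real-valued function that is $C^{k+2}$ in $(\varepsilon,x)$ near $(0,0)$, and suppose that near $(0,0)$ the variable $p_0$ is cyclic ($\partial H^\varepsilon/\partial p_0=0$, so that $q_0$ is conserved by the Hamiltonian system $\dot q_i=\partial H^\varepsilon/\partial p_i$, $\dot p_i=-\partial H^\varepsilon/\partial q_i$, $i=0,\dots,n$) and $$H^\varepsilon(q,p,q_0)=O\big(|(\varepsilon,q_0,q,p)|\,|(q_0,q,p)|\big).$$ Then there is a canonical change of variables $\Phi^\varepsilon:(q,p,q_0,p_0)\mapsto(Q,P,Q_0,P_0)$ near the origin (smooth in $(\varepsilon,x)$, with inverse smooth in $(\varepsilon,X)$, and with symplectic Jacobian matrix) which is near-identity, $\Phi^0(0)=0$ and $\mathrm d\Phi^0[0]=I$, such that $Q_0=q_0$, the variable $P_0$ is cyclic for the transformed Hamiltonian $K^\varepsilon=H^\varepsilon\circ(\Phi^\varepsilon)^{-1}$,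 and the lower-order Hamiltonian $K^\varepsilon(Q,P,0)$, obtained by setting $Q_0=0$, is in Elphick normal form to order $k+1$. That is, with $z=(Q,P)$, $$K^\varepsilon(z,0)=K_2(z)+N(\varepsilon,z)+O(|(\varepsilon,z)|^{k+2}),$$ where $K_2$ is the quadratic part of $K^0(\cdot,0)$ at the origin, $L$ is the matrix of its linear Hamiltonian vector field, and $N$ is a polynomial of degree at most $k+1$ in $(\varepsilon,z)$ with $N(\varepsilon,z)=O(|(\varepsilon,z)|^2)$, $N(0,z)=O(|z|^3)$ and $$\mathrm d_zN(\varepsilon,z)\,[L^{\mathrm T}z]=0\quad\text{for all }\varepsilon,z$$ (equivalently, $N(\varepsilon,\mathrm e^{tL^{\mathrm T}}z)=N(\varepsilon,z)$ for all $t\in\mathbb R$). If moreover $(q,p)=0$ is an equilibrium of the original lower-order system (with $q_0=0$) for all sufficiently small $\varepsilon$, then $\Phi^\varepsilon$ and $N$ also satisfy $\Phi^\varepsilon(x)-x=O(|(\varepsilon,q_0,q,p)|\,|(q,p)|)$, $N(\varepsilon,z)=O(|z|^2|(\varepsilon,z)|)$, and the remainder above is $O(|z|^2|(\varepsilon,z)|^{k})$.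 -/

import Mathlib

open Filter Topology Asymptotics
open scoped Matrix ContDiff

namespace HamNF

/-- Phase space of a system with `n` degrees of freedom: the coordinate `Sum.inl i` is `q_i`,
the coordinate `Sum.inr i` is `p_i`. With `n + 1` degrees of freedom, the index `0` carries the
pair `(q_0, p_0)` and the index `i.succ` carries the remaining pairs. -/
abbrev Phase (n : ℕ) : Type := Fin n ⊕ Fin n → ℝ

/-- Parameters `ε ∈ ℝ^m`. -/
abbrev Param (m : ℕ) : Type := Fin m → ℝ

/-- The partial derivative of `K` with respect to the `j`-th canonical coordinate. -/
noncomputable def partialD {n : ℕ} (K : Phase n → ℝ) (j : Fin n ⊕ Fin n) (x : Phase n) : ℝ :=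
  fderiv ℝ K x (Pi.single j 1)

/-- The Hamiltonian vector field of `K`, that is, the right-hand side of
`q̇_i = ∂K/∂p_i`, `ṗ_i = -∂K/∂q_i`. -/
noncomputable def hamVF {n : ℕ} (K : Phase n → ℝ) (x : Phase n) : Phase n :=
  Sum.elim (fun i => partialD K (Sum.inr i) x) (fun i => -partialD K (Sum.inl i) x)

/-- `p_0` is a cyclic variable of the family `H`: near the origin, `∂H^ε/∂p_0 = 0`. -/
def IsCyclicP0 {m n : ℕ} (H : Param m → Phase (n + 1) → ℝ) : Prop :=
  ∀ᶠ y : Param m × Phase (n + 1) in 𝓝 0, partialD (H y.1) (Sum.inr 0) y.2 = 0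

/-- `(q, p, q_0)`: the variables without `p_0` (which is replaced by zero). -/
def dropP0 {n : ℕ} (x : Phase (n + 1)) : Phase (n + 1) := Function.update x (Sum.inr 0) 0

/-- `(q, p)`: the variables without `q_0` and `p_0`. -/
def restrict {n : ℕ} (x : Phase (n + 1)) : Phase n := fun j => x (Sum.map Fin.succ Fin.succ j)

/-- The point of the full phase space with given `(q, p)` and with `q_0 = p_0 = 0`. -/
def extend {n : ℕ} (z : Phase n) : Phase (n + 1) :=
  Sum.elim (Fin.cons 0 fun i => z (Sum.inl i)) (Fin.cons 0 fun i => z (Sum.inr i))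

/-- The Hamiltonian of the lower-order system: `q_0` is set to zero. (If `p_0` is cyclic, its
value is irrelevant; it is set to zero as well.) -/
def lowerOrder {m n : ℕ} (H : Param m → Phase (n + 1) → ℝ) : Param m → Phase n → ℝ :=
  fun ε z => H ε (extend z)

/-- `Φ^ε` is a parameter-dependent canonical change of variables near the origin with inverse
`Ψ^ε`: both are smooth in `(ε, x)`, they are mutually inverse, and the Jacobian matrix of `Φ^ε`
is symplectic. -/
structure IsCanonicalChange {m N : ℕ} (Φ Ψ : Param m → Phase N → Phase N) : Prop where
  smooth : ∀ᶠ y : Param m × Phase N in 𝓝 0, ContDiffAt ℝ ∞ (Function.uncurry Φ) y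
  smooth_inv : ∀ᶠ y : Param m × Phase N in 𝓝 0, ContDiffAt ℝ ∞ (Function.uncurry Ψ) y
  left_inv : ∀ᶠ y : Param m × Phase N in 𝓝 0, Ψ y.1 (Φ y.1 y.2) = y.2
  right_inv : ∀ᶠ y : Param m × Phase N in 𝓝 0, Φ y.1 (Ψ y.1 y.2) = y.2
  symplectic : ∀ᶠ y : Param m × Phase N in 𝓝 0,
    LinearMap.toMatrix' (fderiv ℝ (Φ y.1) y.2 : Phase N →ₗ[ℝ] Phase N) ∈
      Matrix.symplecticGroup (Fin N) ℝ

/-- At `ε = 0` the change of variables fixes the origin and has derivative the identity there. -/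
def IsNearIdentity {m N : ℕ} (Φ : Param m → Phase N → Phase N) : Prop :=
  Φ 0 0 = 0 ∧ fderiv ℝ (Φ 0) 0 = ContinuousLinearMap.id ℝ (Phase N)

/-- The quadratic part at the origin of a Hamiltonian. -/
noncomputable def quadraticPart {n : ℕ} (K : Phase n → ℝ) (z : Phase n) : ℝ :=
  (1 / 2) * fderiv ℝ (fderiv ℝ K) 0 z z

/-- The matrix of the linearisation at the origin of the Hamiltonian vector field of `K`. -/
noncomputable def linearisation {n : ℕ} (K : Phase n → ℝ) :
    Matrix (Fin n ⊕ Fin n) (Fin n ⊕ Fin n) ℝ :=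
  LinearMap.toMatrix' (fderiv ℝ (hamVF K) 0 : Phase n →ₗ[ℝ] Phase n)

/-- The value at `(ε, z)` of a polynomial in the parameters and the phase-space variables. -/
noncomputable def evalAt {m n : ℕ} (P : MvPolynomial (Fin m ⊕ (Fin n ⊕ Fin n)) ℝ)
    (ε : Param m) (z : Phase n) : ℝ :=
  MvPolynomial.eval (Sum.elim ε z) P

/-- Elphick's condition: the derivative of `P(ε, ·)` along the linear vector field `z ↦ Lᵀ z`
vanishes identically, that is, `P(ε, ·)` is invariant under `exp (t Lᵀ)`. -/
def ElphickInvariant {m n : ℕ} (L : Matrix (Fin n ⊕ Fin n) (Fin n ⊕ Fin n) ℝ)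
    (P : MvPolynomial (Fin m ⊕ (Fin n ⊕ Fin n)) ℝ) : Prop :=
  ∀ (ε : Param m) (z : Phase n), fderiv ℝ (evalAt P ε) z (Lᵀ *ᵥ z) = 0

/-- The family `K` is in Elphick normal form to order `k + 1`:
`K^ε(z) = K₂(z) + P(ε, z) + O(|(ε, z)|^(k + 2))`, where `K₂` is the quadratic part at `ε = 0` and
`P` is a polynomial of degree at most `k + 1`, invariant under `exp (t Lᵀ)` with `L` the linear
part at `ε = 0`, with `P(ε, z) = O(|(ε, z)|²)` and `P(0, z) = O(|z|³)`. -/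
def InNormalForm {m n : ℕ} (k : ℕ) (K : Param m → Phase n → ℝ)
    (P : MvPolynomial (Fin m ⊕ (Fin n ⊕ Fin n)) ℝ) : Prop :=
  P.totalDegree ≤ k + 1 ∧
  ElphickInvariant (linearisation (K 0)) P ∧
  (fun y : Param m × Phase n => evalAt P y.1 y.2) =O[𝓝 0] (fun y => ‖y‖ ^ 2) ∧
  (fun z : Phase n => evalAt P 0 z) =O[𝓝 0] (fun z => ‖z‖ ^ 3) ∧
  (fun y : Param m × Phase n => K y.1 y.2 - quadraticPart (K 0) y.2 - evalAt P y.1 y.2)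
    =O[𝓝 0] (fun y => ‖y‖ ^ (k + 2))

end HamNF

namespace HamNF

open MvPolynomial

/-!
Every Hamiltonian `ε^a ⟨v, x⟩^(b + 1)` generates an explicit polynomial symplectic flow, a shear,
because `⟨v, x⟩` is conserved along it; and powers of linear forms span all polynomials. Composing
shears, one can therefore realise the first-order effect `p ↦ p + {p, F}` of an arbitrary polynomial
generator `F`, with no flow to integrate and no power series to sum. If `v` has no `q_0` and no
`p_0` component, the shear fixes `q_0`, commutes with translations of `p_0` and maps the lower-order
phase space to itself.

Give the parameters weight two and the phase-space variables weight one. The leading part of the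
lower-order Hamiltonian is then a quadratic form in `z` alone, and in each higher weight the
homological equation is solved modulo the kernel of the derivative along `Lᵀ z`: for the inner
product `⟨p, q⟩ = p(∂) q` on polynomials the derivatives along `L z` and `Lᵀ z` are adjoint, so the
range of the first is complementary to the kernel of the second. Monomials of degree at least two in
`z` are preserved throughout, which gives the estimates in the case of an equilibrium.
-/

/-! ### Filtrations of the polynomial ring by weight -/

section Filtration

variable {τ R : Type*}

section CommSemiring

variable [CommSemiring R]

/-- The polynomials all of whose monomials have weight at least `r`. -/
noncomputable def filtration (R : Type*) [CommSemiring R] (wt : τ → ℕ) (r : ℕ) :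
    Submodule R (MvPolynomial τ R) :=
  restrictSupport R {s | r ≤ Finsupp.weight wt s}

theorem filtration_antitone (wt : τ → ℕ) : Antitone (filtration R wt) :=
  fun _ _ h _ hp _ hs => h.trans (hp hs)

theorem mem_filtration_zero (wt : τ → ℕ) (p : MvPolynomial τ R) : p ∈ filtration R wt 0 :=
  fun _ _ => Nat.zero_le _

theorem mul_mem_filtration {wt : τ → ℕ} {r t : ℕ} {p q : MvPolynomial τ R}
    (hp : p ∈ filtration R wt r) (hq : q ∈ filtration R wt t) :
    p * q ∈ filtration R wt (r + t) := by
  classical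
  intro s hs
  obtain ⟨a, ha, b, hb, rfl⟩ := Finset.mem_add.1 (support_mul p q hs)
  simpa using add_le_add (hp ha) (hq hb)

theorem monomial_mem_filtration (wt : τ → ℕ) (s : τ →₀ ℕ) (c : R) :
    monomial s c ∈ filtration R wt (Finsupp.weight wt s) :=
  (monomial_mem_restrictSupport R).2 (Or.inl (le_refl (Finsupp.weight wt s)))

theorem X_mem_filtration (wt : τ → ℕ) (i : τ) : X i ∈ filtration R wt (wt i) := by
  simpa [X, Finsupp.weight_single] using monomial_mem_filtration wt (Finsupp.single i 1) (1 : R)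

end CommSemiring

section Component

theorem mem_filtration_of_isWeightedHomogeneous [CommSemiring R] {wt : τ → ℕ} {r : ℕ}
    {p : MvPolynomial τ R} (hp : IsWeightedHomogeneous wt p r) : p ∈ filtration R wt r :=
  fun _ hs => (hp (mem_support_iff.1 hs)).ge

theorem weightedHomogeneousComponent_mem_restrictSupport [CommSemiring R] (wt : τ → ℕ) (r : ℕ)
    {A : Set (τ →₀ ℕ)} {p : MvPolynomial τ R} (hp : p ∈ restrictSupport R A) :
    weightedHomogeneousComponent wt r p ∈ restrictSupport R A := fun s hs => by
  classical
  have hne : coeff s (weightedHomogeneousComponent wt r p) ≠ 0 := mem_support_iff.1 hs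
  rw [coeff_weightedHomogeneousComponent] at hne
  exact hp (mem_support_iff.2 (ite_ne_right_iff.1 hne).2)

variable [CommRing R]

theorem sub_sum_weightedHomogeneousComponent_mem_filtration (wt : τ → ℕ) (r : ℕ)
    (p : MvPolynomial τ R) :
    p - ∑ i ∈ Finset.range r, weightedHomogeneousComponent wt i p ∈ filtration R wt r := by
  classical
  intro s hs
  by_contra hlt
  have hmem : Finsupp.weight wt s ∈ Finset.range r := Finset.mem_range.2 (not_le.1 hlt)
  have hzero : coeff s (p - ∑ i ∈ Finset.range r, weightedHomogeneousComponent wt i p) = 0 := by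
    simp only [coeff_sub, coeff_sum, coeff_weightedHomogeneousComponent, Finset.sum_ite_eq, hmem,
      if_true, sub_self]
  exact mem_support_iff.1 hs hzero

theorem sub_weightedHomogeneousComponent_mem_filtration {wt : τ → ℕ} {r : ℕ}
    {p : MvPolynomial τ R} (hp : p ∈ filtration R wt r) :
    p - weightedHomogeneousComponent wt r p ∈ filtration R wt (r + 1) := by
  classical
  have h := sub_sum_weightedHomogeneousComponent_mem_filtration wt (r + 1) p
  rw [Finset.sum_range_succ, Finset.sum_eq_zero, zero_add] at h
  · exact h
  · intro i hi
    refine weightedHomogeneousComponent_eq_zero' i p fun s hs => ?_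
    exact ((Finset.mem_range.1 hi).trans_le (hp hs)).ne'

end Component

variable [CommRing R]

/-- An algebra endomorphism of the polynomial ring whose deviation from the identity raises
weights by at least `d`. -/
def Raises (wt : τ → ℕ) (d : ℕ) (θ : MvPolynomial τ R →ₐ[R] MvPolynomial τ R) : Prop :=
  ∀ ⦃r : ℕ⦄ ⦃p : MvPolynomial τ R⦄, p ∈ filtration R wt r → θ p - p ∈ filtration R wt (r + d)

variable {wt : τ → ℕ} {d : ℕ} {θ θ₁ θ₂ : MvPolynomial τ R →ₐ[R] MvPolynomial τ R}

theorem map_mul_sub_mul_mem_filtration {r t : ℕ} {p q : MvPolynomial τ R}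
    (hp : p ∈ filtration R wt r) (hq : q ∈ filtration R wt t)
    (hθp : θ p - p ∈ filtration R wt (r + d)) (hθq : θ q - q ∈ filtration R wt (t + d)) :
    θ (p * q) - p * q ∈ filtration R wt (r + t + d) := by
  have hθp' : θ p ∈ filtration R wt r := by
    simpa using add_mem (filtration_antitone wt (Nat.le_add_right r d) hθp) hp
  have h : θ (p * q) - p * q = θ p * (θ q - q) + (θ p - p) * q := by
    rw [map_mul]
    ring
  rw [h]
  refine add_mem ?_ ?_
  · simpa only [add_assoc] using mul_mem_filtration hθp' hθq
  · simpa only [add_right_comm] using mul_mem_filtration hθp hq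

theorem Raises.of_X (h : ∀ i, θ (X i) - X i ∈ filtration R wt (wt i + d)) : Raises wt d θ := by
  have hadd : ∀ s t : τ →₀ ℕ,
      θ (monomial s 1) - monomial s 1 ∈ filtration R wt (Finsupp.weight wt s + d) →
      θ (monomial t 1) - monomial t 1 ∈ filtration R wt (Finsupp.weight wt t + d) →
      θ (monomial (s + t) 1) - monomial (s + t) 1 ∈
        filtration R wt (Finsupp.weight wt (s + t) + d) := fun s t hs ht => by
    have e : monomial (s + t) (1 : R) = monomial s 1 * monomial t 1 := by
      rw [monomial_mul, mul_one]
    rw [e, map_add]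
    exact map_mul_sub_mul_mem_filtration (monomial_mem_filtration wt s 1)
      (monomial_mem_filtration wt t 1) hs ht
  have hmon : ∀ s : τ →₀ ℕ,
      θ (monomial s 1) - monomial s 1 ∈ filtration R wt (Finsupp.weight wt s + d) := fun s => by
    induction s using Finsupp.induction_linear with
    | zero => simp
    | add s t hs ht => exact hadd s t hs ht
    | single i b =>
      induction b with
      | zero => simp
      | succ b ih =>
        rw [Finsupp.single_add]
        exact hadd _ _ ih (by simpa [X, Finsupp.weight_single] using h i)
  intro r p hp
  rw [p.as_sum, map_sum, ← Finset.sum_sub_distrib]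
  refine sum_mem fun s hs => filtration_antitone wt (Nat.add_le_add_right (hp hs) d) ?_
  have e : monomial s (coeff s p) = coeff s p • monomial s 1 := by
    rw [smul_monomial, smul_eq_mul, mul_one]
  rw [e, map_smul, ← smul_sub]
  exact Submodule.smul_mem _ _ (hmon s)

theorem Raises.map_mem (hθ : Raises wt d θ) {r : ℕ} {p : MvPolynomial τ R}
    (hp : p ∈ filtration R wt r) : θ p ∈ filtration R wt r := by
  simpa using add_mem (filtration_antitone wt (Nat.le_add_right r d) (hθ hp)) hp

theorem Raises.id (wt : τ → ℕ) (d : ℕ) : Raises wt d (AlgHom.id R (MvPolynomial τ R)) :=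
  fun _ _ _ => by simp

theorem Raises.comp (h₁ : Raises wt d θ₁) (h₂ : Raises wt d θ₂) :
    Raises wt d (θ₁.comp θ₂) := fun r p hp => by
  have h : θ₁.comp θ₂ p - p = θ₁ (θ₂ p - p) + (θ₁ p - p) := by simp
  rw [h]
  exact add_mem (h₁.map_mem (h₂ hp)) (h₁ hp)

end Filtration

/-! ### The Fischer inner product -/

section Fischer

variable {τ : Type*} [Fintype τ]

/-- The Fischer inner product, for which monomials are orthogonal and `⟨y^s, y^s⟩ = s!`. -/
noncomputable def fischer :
    MvPolynomial τ ℝ →ₗ[ℝ] MvPolynomial τ ℝ →ₗ[ℝ] ℝ :=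
  (basisMonomials τ ℝ).constr ℝ fun s => ((∏ i, (s i).factorial : ℕ) : ℝ) • lcoeff ℝ s

theorem fischer_monomial (s : τ →₀ ℕ) (c : ℝ) (Q : MvPolynomial τ ℝ) :
    fischer (monomial s c) Q = c * ((∏ i, (s i).factorial : ℕ) : ℝ) * coeff s Q := by
  have h : monomial s c = c • basisMonomials τ ℝ s := by
    simp [smul_monomial]
  rw [h, map_smul, fischer, Module.Basis.constr_basis]
  simp [mul_assoc]

theorem fischer_eq_sum (P Q : MvPolynomial τ ℝ) :
    fischer P Q = ∑ s ∈ P.support, coeff s P * ((∏ i, (s i).factorial : ℕ) : ℝ) * coeff s Q := by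
  conv_lhs => rw [P.as_sum]
  rw [map_sum, LinearMap.sum_apply]
  simp_rw [fischer_monomial]

theorem fischer_comm (P Q : MvPolynomial τ ℝ) : fischer P Q = fischer Q P := by
  classical
  have h : ∀ P Q : MvPolynomial τ ℝ, fischer P Q =
      ∑ s ∈ P.support ∪ Q.support,
        coeff s P * ((∏ i, (s i).factorial : ℕ) : ℝ) * coeff s Q := fun P Q => by
    rw [fischer_eq_sum]
    refine Finset.sum_subset Finset.subset_union_left fun s _ hs => ?_
    simp [notMem_support_iff.1 hs]
  rw [h P Q, h Q P, Finset.union_comm]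
  exact Finset.sum_congr rfl fun s _ => by ring

theorem fischer_self_pos {P : MvPolynomial τ ℝ} (hP : P ≠ 0) : 0 < fischer P P := by
  rw [fischer_eq_sum]
  refine Finset.sum_pos (fun s hs => ?_) (support_nonempty.2 hP)
  have hfact : (0 : ℝ) < ((∏ i, (s i).factorial : ℕ) : ℝ) :=
    Nat.cast_pos.2 (Finset.prod_pos fun i _ => Nat.factorial_pos _)
  rw [mul_right_comm]
  exact mul_pos (mul_self_pos.2 (mem_support_iff.1 hs)) hfact

theorem prod_factorial_add_single (s : τ →₀ ℕ) (i : τ) :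
    ∏ j, ((s + Finsupp.single i 1 : τ →₀ ℕ) j).factorial = (s i + 1) * ∏ j, (s j).factorial := by
  classical
  rw [← Finset.mul_prod_erase _ _ (Finset.mem_univ i),
    ← Finset.mul_prod_erase _ (fun j => (s j).factorial) (Finset.mem_univ i), ← mul_assoc]
  congr 1
  · simp [Nat.factorial_succ]
  · refine Finset.prod_congr rfl fun j hj => ?_
    simp [(Finset.ne_of_mem_erase hj).symm]

theorem fischer_X_mul (i : τ) (P Q : MvPolynomial τ ℝ) :
    fischer (X i * P) Q = fischer P (pderiv i Q) := by
  induction P using MvPolynomial.induction_on' with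
  | add p q hp hq => simp only [mul_add, map_add, LinearMap.add_apply, hp, hq]
  | monomial s c =>
    have e : X i * monomial s c = monomial (s + Finsupp.single i 1) c := by
      rw [X, monomial_mul, one_mul, add_comm]
    rw [e, fischer_monomial, fischer_monomial, coeff_pderiv, prod_factorial_add_single]
    push_cast
    ring

theorem exists_mem_forall_apply_sub_eq_zero {V : Type*} [AddCommGroup V] [Module ℝ V]
    (B : V →ₗ[ℝ] V →ₗ[ℝ] ℝ) (hB : ∀ x, x ≠ 0 → 0 < B x x)
    (M : Submodule ℝ V) [FiniteDimensional ℝ M] (F : V) :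
    ∃ x ∈ M, ∀ y ∈ M, B (F - x) y = 0 := by
  let φ : M →ₗ[ℝ] Module.Dual ℝ M := B.domRestrict₁₂ M M
  have hinj : Function.Injective φ := by
    rw [injective_iff_map_eq_zero]
    intro x hx
    by_contra hne
    have hxx : B x x = 0 := LinearMap.congr_fun hx x
    exact (hB x fun h => hne (Subtype.ext h)).ne' hxx
  have hsurj : Function.Surjective φ :=
    (LinearMap.injective_iff_surjective_of_finrank_eq_finrank
      (Subspace.dual_finrank_eq (K := ℝ) (V := M)).symm).1 hinj
  obtain ⟨x, hx⟩ := hsurj ((B F).domRestrict M)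
  refine ⟨x, x.2, fun y hy => ?_⟩
  have hxy : B x y = B F y := LinearMap.congr_fun hx ⟨y, hy⟩
  rw [map_sub, LinearMap.sub_apply, hxy, sub_self]

end Fischer

/-! ### The homological equation -/

section Homological

variable {σ κ : Type*}

/-- The weight giving `2` to the parameters and `1` to the phase-space variables. With it, the
quadratic part of a Hamiltonian at `ε = 0` has lower weight than all other terms. -/
def parWeight : σ ⊕ κ → ℕ := Sum.elim (fun _ => 2) (fun _ => 1)

/-- The weight counting the degree in the phase-space variables. -/
def phaseWeight : σ ⊕ κ → ℕ := Sum.elim (fun _ => 0) (fun _ => 1)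

theorem weight_parWeight [Fintype σ] [Fintype κ] (s : σ ⊕ κ →₀ ℕ) :
    Finsupp.weight parWeight s = 2 * ∑ i, s (Sum.inl i) + ∑ j, s (Sum.inr j) := by
  rw [Finsupp.weight_eq_sum, Fintype.sum_sum_type]
  simp [parWeight, Finset.mul_sum, mul_comm]

theorem weight_phaseWeight [Fintype κ] (s : σ ⊕ κ →₀ ℕ) :
    Finsupp.weight phaseWeight s = ∑ j, s (Sum.inr j) := by
  classical
  induction s using Finsupp.induction_linear with
  | zero => simp
  | add s t hs ht => simp [hs, ht, Finset.sum_add_distrib]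
  | single i b => rcases i with i | j <;> simp [Finsupp.weight_single, phaseWeight,
      Finsupp.single_apply]

section Ridge

variable [Fintype σ] [Fintype κ]

/-- The exponent of the monomial `ε^a z^b`. -/
noncomputable def expo (a : σ → ℕ) (b : κ → ℕ) : σ ⊕ κ →₀ ℕ :=
  Finsupp.equivFunOnFinite.symm (Sum.elim a b)

@[simp] theorem expo_inl (a : σ → ℕ) (b : κ → ℕ) (i : σ) : expo a b (Sum.inl i) = a i := rfl

@[simp] theorem expo_inr (a : σ → ℕ) (b : κ → ℕ) (j : κ) : expo a b (Sum.inr j) = b j := rfl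

theorem expo_self (s : σ ⊕ κ →₀ ℕ) :
    expo (fun i => s (Sum.inl i)) (fun j => s (Sum.inr j)) = s := by
  ext (i | j) <;> rfl

theorem monomial_expo (a : σ → ℕ) (b : κ → ℕ) (c : ℝ) :
    monomial (expo a b) c = C c * ((∏ i, X (Sum.inl i) ^ a i) * ∏ j, X (Sum.inr j) ^ b j) := by
  rw [monomial_eq, Finsupp.prod_fintype _ _ (fun i => pow_zero _), Fintype.prod_sum_type]
  simp

/-- The linear form `⟨v, z⟩` as a polynomial. -/
noncomputable def linForm (σ : Type*) {κ : Type*} [Fintype κ] (v : κ → ℝ) :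
    MvPolynomial (σ ⊕ κ) ℝ :=
  ∑ j, C (v j) * X (Sum.inr j)

/-- The polynomial `ε^a ⟨v, z⟩^b`: the Hamiltonians whose flows are explicit shears. -/
noncomputable def ridge (a : σ → ℕ) (v : κ → ℝ) (b : ℕ) : MvPolynomial (σ ⊕ κ) ℝ :=
  (∏ i, X (Sum.inl i) ^ a i) * linForm σ v ^ b

/-- The polynomials `ε^a ⟨v, z⟩^b` of weight `w` with `b ≥ r`. -/
def ridgeSet (w r : ℕ) : Set (MvPolynomial (σ ⊕ κ) ℝ) :=
  {S | ∃ (a : σ → ℕ) (v : κ → ℝ) (b : ℕ), r ≤ b ∧ 2 * ∑ i, a i + b = w ∧ S = ridge a v b}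

theorem ridge_eq_sum [DecidableEq κ] (a : σ → ℕ) (v : κ → ℝ) (b : ℕ) :
    ridge a v b = ∑ k ∈ Finset.piAntidiag Finset.univ b,
      monomial (expo a k) ((Nat.multinomial Finset.univ k : ℝ) * ∏ j, v j ^ k j) := by
  rw [ridge, linForm, Finset.sum_pow_eq_sum_piAntidiag, Finset.mul_sum]
  refine Finset.sum_congr rfl fun k _ => ?_
  rw [monomial_expo]
  simp_rw [mul_pow, Finset.prod_mul_distrib]
  simp only [map_mul, map_prod, map_pow, map_natCast]
  ring

theorem ridge_isWeightedHomogeneous (a : σ → ℕ) (v : κ → ℝ) (b : ℕ) :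
    IsWeightedHomogeneous parWeight (ridge a v b) (2 * ∑ i, a i + b) := by
  classical
  rw [ridge_eq_sum]
  refine (weightedHomogeneousSubmodule ℝ parWeight _).sum_mem fun k hk =>
    isWeightedHomogeneous_monomial _ _ _ ?_
  simp only [weight_parWeight, expo_inl, expo_inr, (Finset.mem_piAntidiag.1 hk).1]

theorem ridge_mem_filtration_phaseWeight (a : σ → ℕ) (v : κ → ℝ) (b : ℕ) :
    ridge a v b ∈ filtration ℝ phaseWeight b := by
  classical
  rw [ridge_eq_sum]
  refine Submodule.sum_mem _ fun k hk => ?_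
  simpa only [weight_phaseWeight, expo_inr, (Finset.mem_piAntidiag.1 hk).1] using
    monomial_mem_filtration phaseWeight (expo a k)
      ((Nat.multinomial Finset.univ k : ℝ) * ∏ j, v j ^ k j)

theorem isWeightedHomogeneous_of_mem_span_ridgeSet {w r : ℕ} {S : MvPolynomial (σ ⊕ κ) ℝ}
    (hS : S ∈ Submodule.span ℝ (ridgeSet w r)) : IsWeightedHomogeneous parWeight S w := by
  suffices h : Submodule.span ℝ (ridgeSet w r) ≤
      weightedHomogeneousSubmodule ℝ (parWeight : σ ⊕ κ → ℕ) w from h hS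
  refine Submodule.span_le.2 ?_
  rintro _ ⟨a, v, b, -, rfl, rfl⟩
  exact ridge_isWeightedHomogeneous a v b

theorem mem_filtration_of_mem_span_ridgeSet {w r : ℕ} {S : MvPolynomial (σ ⊕ κ) ℝ}
    (hS : S ∈ Submodule.span ℝ (ridgeSet w r)) : S ∈ filtration ℝ phaseWeight r := by
  suffices h : Submodule.span ℝ (ridgeSet w r) ≤ filtration ℝ phaseWeight r from h hS
  refine Submodule.span_le.2 ?_
  rintro _ ⟨a, v, b, hrb, -, rfl⟩
  exact filtration_antitone _ hrb (ridge_mem_filtration_phaseWeight a v b)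

/-- The part of degree `b` in `z` of the coefficient of `ε^a` in `G`. -/
noncomputable def phaseSlice [DecidableEq κ] (a : σ → ℕ) (b : ℕ) (G : MvPolynomial (σ ⊕ κ) ℝ) :
    MvPolynomial κ ℝ :=
  ∑ k ∈ Finset.piAntidiag Finset.univ b,
    monomial (Finsupp.equivFunOnFinite.symm k) (coeff (expo a k) G)

theorem coeff_phaseSlice [DecidableEq κ] (a : σ → ℕ) (k : κ → ℕ) (G : MvPolynomial (σ ⊕ κ) ℝ) :
    coeff (Finsupp.equivFunOnFinite.symm k) (phaseSlice a (∑ j, k j) G) = coeff (expo a k) G := by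
  simp only [phaseSlice, coeff_sum, coeff_monomial]
  rw [Finset.sum_eq_single k]
  · rw [if_pos rfl]
  · intro l _ hl
    rw [if_neg (by simpa using hl)]
  · intro hk
    exact absurd (Finset.mem_piAntidiag.2 ⟨rfl, fun i _ => Finset.mem_univ i⟩) hk

-- The multinomial coefficients of `⟨v, z⟩^b` cancel against the factorials of the inner product.
theorem fischer_ridge [DecidableEq κ] (a : σ → ℕ) (v : κ → ℝ) (b : ℕ)
    (G : MvPolynomial (σ ⊕ κ) ℝ) :
    fischer (ridge a v b) G =
      ((∏ i, (a i).factorial) * b.factorial : ℕ) * eval v (phaseSlice a b G) := by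
  rw [ridge_eq_sum, map_sum, LinearMap.sum_apply, phaseSlice, map_sum, Finset.mul_sum]
  refine Finset.sum_congr rfl fun k hk => ?_
  have hfact := Nat.multinomial_spec Finset.univ k
  rw [(Finset.mem_piAntidiag.1 hk).1] at hfact
  rw [fischer_monomial, Fintype.prod_sum_type, eval_monomial,
    Finsupp.prod_fintype _ _ (fun i => pow_zero _), ← hfact]
  simp only [expo_inl, expo_inr, Finsupp.equivFunOnFinite_symm_apply_apply]
  push_cast
  ring

theorem eq_zero_of_fischer_ridgeSet {w r : ℕ} {G : MvPolynomial (σ ⊕ κ) ℝ}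
    (hw : IsWeightedHomogeneous parWeight G w) (hr : G ∈ filtration ℝ phaseWeight r)
    (h : ∀ S ∈ ridgeSet w r, fischer S G = 0) : G = 0 := by
  classical
  ext s
  by_contra hs
  set a : σ → ℕ := fun i => s (Sum.inl i) with ha
  set k : κ → ℕ := fun j => s (Sum.inr j) with hk
  have hrk : r ≤ ∑ j, k j := weight_phaseWeight s ▸ hr (mem_support_iff.2 hs)
  have hwk : 2 * ∑ i, a i + ∑ j, k j = w := by rw [← hw hs, weight_parWeight]
  have hslice : phaseSlice a (∑ j, k j) G = 0 := MvPolynomial.funext fun v => by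
    have hfischer := h (ridge a v (∑ j, k j)) ⟨a, v, _, hrk, hwk, rfl⟩
    rw [fischer_ridge] at hfischer
    refine ((mul_eq_zero.1 hfischer).resolve_left ?_).trans (map_zero _).symm
    exact Nat.cast_ne_zero.2 (mul_ne_zero
      (Finset.prod_ne_zero_iff.2 fun i _ => Nat.factorial_ne_zero _) (Nat.factorial_ne_zero _))
  have hcoeff := coeff_phaseSlice a k G
  rw [hslice, coeff_zero, ha, hk, expo_self] at hcoeff
  exact hs hcoeff.symm

end Ridge

section DerivAlong

variable [Fintype κ]

/-- The derivative along the linear vector field `z ↦ L z`. -/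
noncomputable def derivAlong (L : Matrix κ κ ℝ) :
    MvPolynomial (σ ⊕ κ) ℝ →ₗ[ℝ] MvPolynomial (σ ⊕ κ) ℝ :=
  ∑ i, ∑ j, L i j • (LinearMap.mulLeft ℝ (X (Sum.inr j)) ∘ₗ
    (pderiv (R := ℝ) (Sum.inr i : σ ⊕ κ)).toLinearMap)

theorem derivAlong_apply (L : Matrix κ κ ℝ) (P : MvPolynomial (σ ⊕ κ) ℝ) :
    derivAlong L P = ∑ i, ∑ j, L i j • (X (Sum.inr j) * pderiv (Sum.inr i) P) := by
  simp [derivAlong, LinearMap.sum_apply]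

theorem fischer_derivAlong [Fintype σ] (L : Matrix κ κ ℝ) (P Q : MvPolynomial (σ ⊕ κ) ℝ) :
    fischer (derivAlong L P) Q = fischer P (derivAlong Lᵀ Q) := by
  simp only [derivAlong_apply, map_sum, LinearMap.sum_apply, map_smul, LinearMap.smul_apply,
    fischer_X_mul]
  rw [Finset.sum_comm]
  refine Finset.sum_congr rfl fun i _ => Finset.sum_congr rfl fun j _ => ?_
  rw [fischer_comm P, fischer_X_mul, fischer_comm, Matrix.transpose_apply]

-- A linear vector field trades one phase-space variable for another in every monomial.
theorem derivAlong_mem_restrictSupport (L : Matrix κ κ ℝ) {A : Set (σ ⊕ κ →₀ ℕ)}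
    (hA : ∀ (s : σ ⊕ κ →₀ ℕ) (i j : κ), s + Finsupp.single (Sum.inr i) 1 ∈ A →
      s + Finsupp.single (Sum.inr j) 1 ∈ A)
    {P : MvPolynomial (σ ⊕ κ) ℝ} (hP : P ∈ restrictSupport ℝ A) :
    derivAlong L P ∈ restrictSupport ℝ A := by
  classical
  rw [derivAlong_apply]
  refine sum_mem fun i _ => sum_mem fun j _ => Submodule.smul_mem _ _ fun s hs => ?_
  have hs' : coeff s (X (Sum.inr j) * pderiv (Sum.inr i) P) ≠ 0 := mem_support_iff.1 hs
  rw [coeff_X_mul'] at hs'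
  split_ifs at hs' with hj
  · have hle : Finsupp.single (Sum.inr j) 1 ≤ s :=
      Finsupp.single_le_iff.2 (Nat.one_le_iff_ne_zero.2 (Finsupp.mem_support_iff.1 hj))
    rw [coeff_pderiv] at hs'
    simpa only [tsub_add_cancel_of_le hle] using
      hA _ i j (hP (mem_support_iff.2 (left_ne_zero_of_mul hs')))
  · exact absurd rfl hs'

theorem derivAlong_isWeightedHomogeneous (L : Matrix κ κ ℝ) {wt : σ ⊕ κ → ℕ}
    (hwt : ∀ j, wt (Sum.inr j) = 1) {w : ℕ} {P : MvPolynomial (σ ⊕ κ) ℝ}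
    (hP : IsWeightedHomogeneous wt P w) : IsWeightedHomogeneous wt (derivAlong L P) w := by
  intro s hs
  refine derivAlong_mem_restrictSupport L (A := {s | Finsupp.weight wt s = w}) ?_
    (fun s hs => hP (mem_support_iff.1 hs)) (mem_support_iff.2 hs)
  intro s i j h
  simpa [Finsupp.weight_single, hwt] using h

theorem derivAlong_weightedHomogeneousComponent (L : Matrix κ κ ℝ) {wt : σ ⊕ κ → ℕ}
    (hwt : ∀ j, wt (Sum.inr j) = 1) (w : ℕ) (P : MvPolynomial (σ ⊕ κ) ℝ) :
    derivAlong L (weightedHomogeneousComponent wt w P) =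
      weightedHomogeneousComponent wt w (derivAlong L P) := by
  classical
  induction P using MvPolynomial.induction_on' with
  | add p q hp hq => simp only [map_add, hp, hq]
  | monomial s c =>
    have hs := isWeightedHomogeneous_monomial wt s c rfl
    rw [weightedHomogeneousComponent_of_mem hs,
      weightedHomogeneousComponent_of_mem (derivAlong_isWeightedHomogeneous L hwt hs)]
    split_ifs
    · rfl
    · exact map_zero _

theorem derivAlong_mem_filtration_phaseWeight (L : Matrix κ κ ℝ) {r : ℕ}
    {P : MvPolynomial (σ ⊕ κ) ℝ} (hP : P ∈ filtration ℝ phaseWeight r) :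
    derivAlong L P ∈ filtration ℝ phaseWeight r := by
  refine derivAlong_mem_restrictSupport L (fun s i j h => ?_) hP
  simpa [Finsupp.weight_single, phaseWeight] using h

theorem derivAlong_mem_filtration_phaseWeight_one (L : Matrix κ κ ℝ)
    (P : MvPolynomial (σ ⊕ κ) ℝ) : derivAlong L P ∈ filtration ℝ phaseWeight 1 := by
  rw [derivAlong_apply]
  refine sum_mem fun i _ => sum_mem fun j _ => Submodule.smul_mem _ _ ?_
  exact mul_mem_filtration (X_mem_filtration phaseWeight (Sum.inr j)) (mem_filtration_zero _ _)

end DerivAlong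

variable [Fintype σ] [Fintype κ]

theorem finiteDimensional_span_ridgeSet (w r : ℕ) :
    FiniteDimensional ℝ (Submodule.span ℝ (ridgeSet (σ := σ) (κ := κ) w r)) := by
  have : Finite {s : σ ⊕ κ →₀ ℕ | Finsupp.weight parWeight s = w} := by
    refine Finsupp.finite_of_nat_weight_eq _ ?_ w
    rintro (_ | _) <;> simp [parWeight]
  have : FiniteDimensional ℝ
      (restrictSupport ℝ {s : σ ⊕ κ →₀ ℕ | Finsupp.weight parWeight s = w}) :=
    Module.Finite.of_basis (basisRestrictSupport ℝ _)
  have hle : Submodule.span ℝ (ridgeSet w r) ≤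
      restrictSupport ℝ {s : σ ⊕ κ →₀ ℕ | Finsupp.weight parWeight s = w} := fun S hS s hs =>
    isWeightedHomogeneous_of_mem_span_ridgeSet hS (mem_support_iff.1 hs)
  exact Submodule.finiteDimensional_of_le hle

-- `S` comes from the orthogonal projection of `F` onto the image of `derivAlong L`, whose
-- orthogonal complement is the kernel of the adjoint `derivAlong Lᵀ`.
theorem exists_derivAlong_transpose_sub_eq_zero (L : Matrix κ κ ℝ) {w r : ℕ}
    {F : MvPolynomial (σ ⊕ κ) ℝ} (hF : IsWeightedHomogeneous parWeight F w)
    (hr : derivAlong Lᵀ F ∈ filtration ℝ phaseWeight r) :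
    ∃ S ∈ Submodule.span ℝ (ridgeSet w r), derivAlong Lᵀ (F - derivAlong L S) = 0 := by
  have := finiteDimensional_span_ridgeSet (σ := σ) (κ := κ) w r
  obtain ⟨_, ⟨S, hS, rfl⟩, horth⟩ := exists_mem_forall_apply_sub_eq_zero fischer
    (fun _ => fischer_self_pos) ((Submodule.span ℝ (ridgeSet w r)).map (derivAlong L)) F
  have hSw := isWeightedHomogeneous_of_mem_span_ridgeSet hS
  refine ⟨S, hS, eq_zero_of_fischer_ridgeSet (w := w) (r := r) ?_ ?_ fun S' hS' => ?_⟩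
  · exact derivAlong_isWeightedHomogeneous _ (fun _ => rfl)
      ((weightedHomogeneousSubmodule ℝ parWeight w).sub_mem hF
        (derivAlong_isWeightedHomogeneous L (fun _ => rfl) hSw))
  · rw [map_sub]
    exact sub_mem hr (derivAlong_mem_filtration_phaseWeight _
      (derivAlong_mem_filtration_phaseWeight L (mem_filtration_of_mem_span_ridgeSet hS)))
  · rw [← fischer_derivAlong, fischer_comm]
    exact horth _ (Submodule.mem_map_of_mem (Submodule.subset_span hS'))

end Homological

/-! ### Taylor polynomials with anisotropic remainders -/

section Taylor

variable {τ : Type*} [DecidableEq τ]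

/-- The point `y` with the coordinates in `s` multiplied by `t`. -/
def rayPt (s : Finset τ) (t : ℝ) (y : τ → ℝ) : τ → ℝ := fun i => if i ∈ s then t * y i else y i

/-- The point `y` with the coordinates outside `s` replaced by zero. -/
def part (s : Finset τ) (y : τ → ℝ) : τ → ℝ := fun i => if i ∈ s then y i else 0

@[simp] theorem rayPt_one (s : Finset τ) (y : τ → ℝ) : rayPt s 1 y = y := by
  ext i
  simp [rayPt]

theorem hasDerivAt_rayPt (s : Finset τ) (y : τ → ℝ) (t : ℝ) :
    HasDerivAt (fun t => rayPt s t y) (part s y) t := by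
  refine hasDerivAt_pi.2 fun i => ?_
  by_cases hi : i ∈ s
  · simpa [rayPt, part, hi] using (hasDerivAt_id t).mul_const (y i)
  · simpa [rayPt, part, hi] using hasDerivAt_const t (y i)

theorem part_eq_sum (s : Finset τ) (y : τ → ℝ) :
    part s y = ∑ i ∈ s, y i • (Pi.single i 1 : τ → ℝ) := by
  ext j
  simp [part, Finset.sum_apply, Pi.single_apply]

theorem eval_rayPt_monomial (s : Finset τ) (t : ℝ) (y : τ → ℝ) (m : τ →₀ ℕ) (c : ℝ) :
    eval (rayPt s t y) (monomial m c) = t ^ (∑ i ∈ s, m i) * eval y (monomial m c) := by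
  have h : ∀ i, rayPt s t y i = (if i ∈ s then t else 1) * y i := fun i => by
    by_cases hi : i ∈ s <;> simp [rayPt, hi]
  have hsum : ∑ i ∈ m.support ∩ s, m i = ∑ i ∈ s, m i :=
    Finset.sum_subset Finset.inter_subset_right fun i hi hi' => by
      simpa [hi] using hi'
  simp_rw [eval_monomial, Finsupp.prod, h, mul_pow, Finset.prod_mul_distrib, ite_pow, one_pow]
  rw [Finset.prod_ite_mem, Finset.prod_pow_eq_pow_sum, hsum]
  ring

/-- The primitive along rays in the directions `s` of the one-form `∑ i ∈ s, q i dy_i`. -/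
noncomputable def primitive {τ : Type*} (s : Finset τ) (q : τ → MvPolynomial τ ℝ) :
    MvPolynomial τ ℝ :=
  ∑ i ∈ s, ∑ m ∈ (q i).support,
    monomial (m + Finsupp.single i 1) (coeff m (q i) / ((∑ j ∈ s, m j : ℕ) + 1))

theorem sum_add_single_apply {τ : Type*} {s : Finset τ} {i : τ} (hi : i ∈ s) (m : τ →₀ ℕ) :
    ∑ j ∈ s, (m + Finsupp.single i 1 : τ →₀ ℕ) j = ∑ j ∈ s, m j + 1 := by
  classical
  simp only [Finsupp.add_apply, Finset.sum_add_distrib, Finsupp.single_apply]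
  rw [Finset.sum_ite_eq, if_pos hi]

theorem hasDerivAt_eval_rayPt_monomial {s : Finset τ} {i : τ} (hi : i ∈ s) (m : τ →₀ ℕ) (c : ℝ)
    (y : τ → ℝ) (t : ℝ) :
    HasDerivAt (fun t => eval (rayPt s t y)
        (monomial (m + Finsupp.single i 1) (c / ((∑ j ∈ s, m j : ℕ) + 1))))
      (y i * eval (rayPt s t y) (monomial m c)) t := by
  have hne : ((∑ j ∈ s, m j : ℕ) : ℝ) + 1 ≠ 0 := by positivity
  have heval : eval y (monomial (m + Finsupp.single i 1) (c / ((∑ j ∈ s, m j : ℕ) + 1))) =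
      y i * eval y (monomial m c) / ((∑ j ∈ s, m j : ℕ) + 1) := by
    rw [div_eq_mul_inv, ← monomial_mul, map_mul, eval_monomial (s := Finsupp.single i 1),
      Finsupp.prod_single_index (h := fun j e => y j ^ e) (pow_zero _), pow_one]
    ring
  simp_rw [eval_rayPt_monomial]
  rw [sum_add_single_apply hi, heval]
  refine ((hasDerivAt_pow (∑ j ∈ s, m j + 1) t).mul_const _).congr_deriv ?_
  rw [Nat.add_sub_cancel, Nat.cast_add_one]
  field_simp

theorem hasDerivAt_eval_rayPt_primitive (s : Finset τ) (q : τ → MvPolynomial τ ℝ) (y : τ → ℝ)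
    (t : ℝ) :
    HasDerivAt (fun t => eval (rayPt s t y) (primitive s q))
      (∑ i ∈ s, y i * eval (rayPt s t y) (q i)) t := by
  have hsum : ∀ i, y i * eval (rayPt s t y) (q i) =
      ∑ m ∈ (q i).support, y i * eval (rayPt s t y) (monomial m (coeff m (q i))) := fun i => by
    rw [← Finset.mul_sum, ← map_sum, ← (q i).as_sum]
  simp only [primitive, map_sum, hsum]
  exact HasDerivAt.fun_sum fun i hi => HasDerivAt.fun_sum fun m _ =>
    hasDerivAt_eval_rayPt_monomial hi m _ y t

theorem eval_rayPt_zero_primitive (s : Finset τ) (q : τ → MvPolynomial τ ℝ) (y : τ → ℝ) :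
    eval (rayPt s 0 y) (primitive s q) = 0 := by
  simp only [primitive, map_sum]
  refine Finset.sum_eq_zero fun i hi => Finset.sum_eq_zero fun m _ => ?_
  rw [eval_rayPt_monomial, sum_add_single_apply hi, zero_pow (Nat.succ_ne_zero _), zero_mul]

theorem hasDerivAt_comp_rayPt_sub_primitive [Finite τ] (s : Finset τ)
    {f : (τ → ℝ) → ℝ} (q : τ → MvPolynomial τ ℝ) {y : τ → ℝ} {t : ℝ}
    (hf : DifferentiableAt ℝ f (rayPt s t y)) :
    HasDerivAt (fun t => f (rayPt s t y) - eval (rayPt s t y) (primitive s q))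
      (∑ i ∈ s, y i * (fderiv ℝ f (rayPt s t y) (Pi.single i 1) - eval (rayPt s t y) (q i))) t := by
  have := Fintype.ofFinite τ
  refine ((hf.hasFDerivAt.comp_hasDerivAt t (hasDerivAt_rayPt s y t)).sub
    (hasDerivAt_eval_rayPt_primitive s q y t)).congr_deriv ?_
  simp only [part_eq_sum, map_sum, map_smul, smul_eq_mul, mul_sub, Finset.sum_sub_distrib]

variable [Fintype τ]

theorem norm_rayPt_le (s : Finset τ) {t : ℝ} (ht : t ∈ Set.Icc (0 : ℝ) 1) (y : τ → ℝ) :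
    ‖rayPt s t y‖ ≤ ‖y‖ := by
  refine (pi_norm_le_iff_of_nonneg (norm_nonneg _)).2 fun i => ?_
  have h := norm_le_pi_norm y i
  rw [rayPt]
  split_ifs
  · rw [norm_mul, Real.norm_of_nonneg ht.1]
    exact (mul_le_of_le_one_left (norm_nonneg _) ht.2).trans h
  · exact h

theorem norm_part_rayPt_le (s : Finset τ) {t : ℝ} (ht : t ∈ Set.Icc (0 : ℝ) 1) (y : τ → ℝ) :
    ‖part s (rayPt s t y)‖ ≤ ‖part s y‖ := by
  have h : part s (rayPt s t y) = rayPt s t (part s y) := by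
    ext i
    by_cases hi : i ∈ s <;> simp [part, rayPt, hi]
  rw [h]
  exact norm_rayPt_le s ht _

theorem norm_apply_le_norm_part {s : Finset τ} {i : τ} (hi : i ∈ s) (y : τ → ℝ) :
    ‖y i‖ ≤ ‖part s y‖ := by
  simpa [part, hi] using norm_le_pi_norm (part s y) i

-- Integrating along rays the approximation of the partial derivatives gains a factor `‖part s y‖`.
theorem isBigO_sub_primitive (s : Finset τ) {f g : (τ → ℝ) → ℝ} {q : τ → MvPolynomial τ ℝ}
    (hf : ∀ᶠ y in 𝓝 0, DifferentiableAt ℝ f y)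
    (hg : ∀ t ∈ Set.Icc (0 : ℝ) 1, ∀ y, ‖g (rayPt s t y)‖ ≤ ‖g y‖)
    (hq : ∀ i ∈ s, (fun y => fderiv ℝ f y (Pi.single i 1) - eval y (q i)) =O[𝓝 0] g) :
    (fun y => f y - f (rayPt s 0 y) - eval y (primitive s q)) =O[𝓝 0]
      fun y => ‖part s y‖ * g y := by
  let err : τ → (τ → ℝ) → ℝ := fun i y => fderiv ℝ f y (Pi.single i 1) - eval y (q i)
  have herr : (fun y => ∑ i ∈ s, ‖err i y‖) =O[𝓝 0] g :=
    IsBigO.fun_sum fun i hi => (hq i hi).norm_left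
  obtain ⟨c, hc, hbound⟩ := herr.exists_nonneg
  obtain ⟨δ, hδ, hball⟩ := Metric.eventually_nhds_iff_ball.1 (hf.and hbound.bound)
  refine IsBigO.of_bound c ?_
  filter_upwards [Metric.ball_mem_nhds (0 : τ → ℝ) hδ] with y hy
  have hmem : ∀ t ∈ Set.Icc (0 : ℝ) 1, rayPt s t y ∈ Metric.ball (0 : τ → ℝ) δ := fun t ht =>
    mem_ball_zero_iff.2 ((norm_rayPt_le s ht y).trans_lt (mem_ball_zero_iff.1 hy))
  have hderiv : ∀ t ∈ Set.Ico (0 : ℝ) 1,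
      ‖∑ i ∈ s, y i * err i (rayPt s t y)‖ ≤ c * (‖part s y‖ * ‖g y‖) := fun t ht => by
    have ht' := Set.Ico_subset_Icc_self ht
    have hsum := (Real.le_norm_self _).trans (hball _ (hmem t ht')).2
    calc ‖∑ i ∈ s, y i * err i (rayPt s t y)‖
        ≤ ∑ i ∈ s, ‖part s y‖ * ‖err i (rayPt s t y)‖ := norm_sum_le_of_le _ fun i hi => by
          rw [norm_mul]
          exact mul_le_mul_of_nonneg_right (norm_apply_le_norm_part hi y) (norm_nonneg _)
      _ ≤ ‖part s y‖ * (c * ‖g (rayPt s t y)‖) := by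
          rw [← Finset.mul_sum]
          gcongr
      _ ≤ ‖part s y‖ * (c * ‖g y‖) := by
          gcongr
          exact hg t ht' y
      _ = c * (‖part s y‖ * ‖g y‖) := by ring
  have hmean := norm_image_sub_le_of_norm_deriv_le_segment_01' (fun t ht =>
    (hasDerivAt_comp_rayPt_sub_primitive s q (hball _ (hmem t ht)).1).hasDerivWithinAt) hderiv
  rw [rayPt_one, eval_rayPt_zero_primitive, sub_zero, sub_right_comm] at hmean
  rwa [norm_mul, norm_norm]

section ContDiffAt

variable {E F : Type*} [NormedAddCommGroup E] [NormedSpace ℝ E] [NormedAddCommGroup F]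
  [NormedSpace ℝ F] {f : E → F} {x : E} {r : ℕ}

theorem contDiffAt_fderiv_apply (hf : ContDiffAt ℝ ((r + 1 : ℕ) : WithTop ℕ∞) f x) (v : E) :
    ContDiffAt ℝ (r : WithTop ℕ∞) (fun y => fderiv ℝ f y v) x :=
  (hf.fderiv_right (by norm_cast)).clm_apply contDiffAt_const

theorem eventually_differentiableAt_of_contDiffAt
    (hf : ContDiffAt ℝ ((r + 1 : ℕ) : WithTop ℕ∞) f x) :
    ∀ᶠ y in 𝓝 x, DifferentiableAt ℝ f y :=
  (hf.eventually (by simp)).mono fun y hy => hy.differentiableAt (by norm_cast)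

end ContDiffAt

theorem exists_eval_sub_isBigO_norm_pow {τ : Type*} [Fintype τ] (r : ℕ) :
    ∀ {f : (τ → ℝ) → ℝ}, ContDiffAt ℝ (r : WithTop ℕ∞) f 0 →
      ∃ p : MvPolynomial τ ℝ, (fun y => f y - eval y p) =O[𝓝 0] fun y => ‖y‖ ^ r := by
  classical
  induction r with
  | zero => exact fun hf => ⟨0, by simpa using hf.continuousAt.tendsto.isBigO_one ℝ⟩
  | succ r ih =>
    intro f hf
    choose q hq using fun i : τ => ih (contDiffAt_fderiv_apply hf (Pi.single i 1))
    have hray : ∀ y : τ → ℝ, rayPt Finset.univ 0 y = 0 := fun y => by ext i; simp [rayPt]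
    have hpart : ∀ y : τ → ℝ, part Finset.univ y = y := fun y => by ext i; simp [part]
    have hle : ∀ t ∈ Set.Icc (0 : ℝ) 1, ∀ y : τ → ℝ,
        ‖‖rayPt Finset.univ t y‖ ^ r‖ ≤ ‖‖y‖ ^ r‖ := fun t ht y => by
      simpa only [norm_pow, norm_norm] using
        pow_le_pow_left₀ (norm_nonneg _) (norm_rayPt_le _ ht y) r
    have hprim := isBigO_sub_primitive Finset.univ (g := fun y => ‖y‖ ^ r)
      (eventually_differentiableAt_of_contDiffAt hf) hle (fun i _ => hq i)
    refine ⟨C (f 0) + primitive Finset.univ q, ?_⟩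
    simpa [hray, hpart, sub_sub, pow_succ'] using hprim

/-- `f` and its partial derivatives of order less than `r` in the directions `s` vanish, near the
origin, where all coordinates in `s` are zero. -/
def VanishesToOrder (s : Finset τ) : ℕ → ((τ → ℝ) → ℝ) → Prop
  | 0, _ => True
  | r + 1, f => (∀ᶠ y in 𝓝 0, f (rayPt s 0 y) = 0) ∧
      ∀ i ∈ s, VanishesToOrder s r fun y => fderiv ℝ f y (Pi.single i 1)

theorem primitive_mem_filtration {τ : Type*} {s : Finset τ} {wt : τ → ℕ} (hwt : ∀ i ∈ s, wt i = 1)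
    {r : ℕ} {q : τ → MvPolynomial τ ℝ} (hq : ∀ i ∈ s, q i ∈ filtration ℝ wt r) :
    primitive s q ∈ filtration ℝ wt (r + 1) := by
  refine sum_mem fun i hi => sum_mem fun m hm => filtration_antitone wt ?_
    (monomial_mem_filtration wt _ _)
  rw [map_add, Finsupp.weight_single, hwt i hi, one_smul]
  exact Nat.add_le_add_right (hq i hi hm) 1

theorem exists_eval_sub_isBigO_of_vanishesToOrder {s : Finset τ} {wt : τ → ℕ}
    (hwt : ∀ i ∈ s, wt i = 1) (d r : ℕ) :
    ∀ {f : (τ → ℝ) → ℝ}, ContDiffAt ℝ ((d + r : ℕ) : WithTop ℕ∞) f 0 → VanishesToOrder s r f →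
      ∃ p ∈ filtration ℝ wt r,
        (fun y => f y - eval y p) =O[𝓝 0] fun y => ‖part s y‖ ^ r * ‖y‖ ^ d := by
  induction r with
  | zero =>
    intro f hf _
    obtain ⟨p, hp⟩ := exists_eval_sub_isBigO_norm_pow d hf
    exact ⟨p, mem_filtration_zero wt p, by simpa using hp⟩
  | succ r ih =>
    intro f hf hvan
    have hq : ∀ i : τ, ∃ q : MvPolynomial τ ℝ, i ∈ s → q ∈ filtration ℝ wt r ∧
        (fun y => fderiv ℝ f y (Pi.single i 1) - eval y q) =O[𝓝 0]
          fun y => ‖part s y‖ ^ r * ‖y‖ ^ d := fun i => by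
      by_cases hi : i ∈ s
      · obtain ⟨q, hq⟩ := ih (contDiffAt_fderiv_apply hf (Pi.single i 1)) (hvan.2 i hi)
        exact ⟨q, fun _ => hq⟩
      · exact ⟨0, fun h => absurd h hi⟩
    choose q hq using hq
    have hle : ∀ t ∈ Set.Icc (0 : ℝ) 1, ∀ y : τ → ℝ,
        ‖‖part s (rayPt s t y)‖ ^ r * ‖rayPt s t y‖ ^ d‖ ≤ ‖‖part s y‖ ^ r * ‖y‖ ^ d‖ :=
      fun t ht y => by
        simp only [norm_mul, norm_pow, norm_norm]
        have hpart := norm_part_rayPt_le s ht y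
        have hray := norm_rayPt_le s ht y
        gcongr
    refine ⟨primitive s q, primitive_mem_filtration hwt fun i hi => (hq i hi).1, ?_⟩
    refine (isBigO_sub_primitive s (eventually_differentiableAt_of_contDiffAt hf) hle
      fun i hi => (hq i hi).2).congr' ?_ ?_
    · filter_upwards [hvan.1] with y hy
      rw [hy, sub_zero]
    · exact Eventually.of_forall fun y => by ring

end Taylor

section PhaseVars

variable {σ κ : Type*} [Fintype κ]

/-- The indices of the phase-space variables. -/
def phaseVars : Finset (σ ⊕ κ) := Finset.univ.map Function.Embedding.inr

theorem norm_part_phaseVars [Fintype σ] [DecidableEq σ] [DecidableEq κ] (y : σ ⊕ κ → ℝ) :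
    ‖part phaseVars y‖ = ‖fun j => y (Sum.inr j)‖ := by
  apply le_antisymm
  · refine (pi_norm_le_iff_of_nonneg (norm_nonneg _)).2 ?_
    rintro (i | j)
    · simp [part, phaseVars]
    · simpa [part, phaseVars] using norm_le_pi_norm (fun j => y (Sum.inr j)) j
  · refine (pi_norm_le_iff_of_nonneg (norm_nonneg _)).2 fun j => ?_
    simpa [part, phaseVars] using norm_le_pi_norm (part phaseVars y) (Sum.inr j)

end PhaseVars

section Bounds

variable {σ κ : Type*} [Fintype σ] [Fintype κ]

theorem weight_one (s : σ ⊕ κ →₀ ℕ) :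
    Finsupp.weight (1 : σ ⊕ κ → ℕ) s = ∑ i, s (Sum.inl i) + ∑ j, s (Sum.inr j) := by
  rw [Finsupp.weight_eq_sum, Fintype.sum_sum_type]
  simp

theorem norm_eval_monomial_le (s : σ ⊕ κ →₀ ℕ) (c : ℝ) (ε : σ → ℝ) (z : κ → ℝ) :
    ‖eval (Sum.elim ε z) (monomial s c)‖ ≤
      ‖c‖ * (‖ε‖ ^ (∑ i, s (Sum.inl i)) * ‖z‖ ^ (∑ j, s (Sum.inr j))) := by
  rw [eval_monomial, Finsupp.prod_fintype _ _ (fun i => pow_zero _), Fintype.prod_sum_type,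
    norm_mul, norm_mul, norm_prod, norm_prod, ← Finset.prod_pow_eq_pow_sum,
    ← Finset.prod_pow_eq_pow_sum]
  simp only [Sum.elim_inl, Sum.elim_inr, norm_pow]
  have hε := norm_le_pi_norm ε
  have hz := norm_le_pi_norm z
  gcongr with i _ i _
  · exact hε i
  · exact hz i

theorem isBigO_eval_monomial {i j : ℕ} {s : σ ⊕ κ →₀ ℕ} (c : ℝ)
    (hi : i ≤ Finsupp.weight phaseWeight s) (hj : i + j ≤ Finsupp.weight 1 s) :
    (fun y : (σ → ℝ) × (κ → ℝ) => eval (Sum.elim y.1 y.2) (monomial s c)) =O[𝓝 0]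
      fun y => ‖y.2‖ ^ i * ‖y‖ ^ j := by
  rw [weight_phaseWeight] at hi
  rw [weight_one] at hj
  refine IsBigO.of_bound ‖c‖ ?_
  filter_upwards [Metric.ball_mem_nhds (0 : (σ → ℝ) × (κ → ℝ)) one_pos] with y hy
  rw [mem_ball_zero_iff] at hy
  refine (norm_eval_monomial_le s c y.1 y.2).trans (mul_le_mul_of_nonneg_left ?_ (norm_nonneg _))
  obtain ⟨b, hb⟩ := Nat.exists_eq_add_of_le hi
  rw [hb, norm_mul, norm_pow, norm_pow, norm_norm, norm_norm]
  calc ‖y.1‖ ^ (∑ i, s (Sum.inl i)) * ‖y.2‖ ^ (i + b)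
      = ‖y.2‖ ^ i * (‖y.1‖ ^ (∑ i, s (Sum.inl i)) * ‖y.2‖ ^ b) := by ring
    _ ≤ ‖y.2‖ ^ i * (‖y‖ ^ (∑ i, s (Sum.inl i)) * ‖y‖ ^ b) := by
        have h1 := norm_fst_le y
        have h2 := norm_snd_le y
        gcongr
    _ ≤ ‖y.2‖ ^ i * ‖y‖ ^ j := by
        rw [← pow_add]
        exact mul_le_mul_of_nonneg_left
          (pow_le_pow_of_le_one (norm_nonneg _) hy.le (by omega)) (by positivity)

theorem isBigO_eval {i j : ℕ} {p : MvPolynomial (σ ⊕ κ) ℝ} (hi : p ∈ filtration ℝ phaseWeight i)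
    (hj : p ∈ filtration ℝ 1 (i + j)) :
    (fun y : (σ → ℝ) × (κ → ℝ) => eval (Sum.elim y.1 y.2) p) =O[𝓝 0]
      fun y => ‖y.2‖ ^ i * ‖y‖ ^ j := by
  have h : (fun y : (σ → ℝ) × (κ → ℝ) => eval (Sum.elim y.1 y.2) p) = fun y =>
      ∑ s ∈ p.support, eval (Sum.elim y.1 y.2) (monomial s (coeff s p)) := by
    ext y
    conv_lhs => rw [p.as_sum]
    rw [map_sum]
  rw [h]
  exact IsBigO.fun_sum fun s hs => isBigO_eval_monomial _ (hi hs) (hj hs)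

theorem ridge_mem_filtration_one (a : σ → ℕ) (v : κ → ℝ) (b : ℕ) :
    ridge a v b ∈ filtration ℝ 1 (∑ i, a i + b) := by
  classical
  rw [ridge_eq_sum]
  refine sum_mem fun k hk => ?_
  simpa only [weight_one, expo_inl, expo_inr, (Finset.mem_piAntidiag.1 hk).1] using
    monomial_mem_filtration 1 (expo a k) ((Nat.multinomial Finset.univ k : ℝ) * ∏ j, v j ^ k j)

end Bounds

/-! ### Symplectic shears -/

section Shear

variable {m N : ℕ}

/-- Multiplication by the standard symplectic matrix, so that `hamVF K = symp (∇ K)`. -/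
def symp (v : Phase N) : Phase N := Sum.elim (fun i => v (Sum.inr i)) (fun i => -v (Sum.inl i))

/-- The linear form `⟨v, ·⟩`. -/
noncomputable def dotCLM (v : Phase N) : Phase N →L[ℝ] ℝ :=
  ∑ j, v j • ContinuousLinearMap.proj j

theorem dotCLM_apply (v x : Phase N) : dotCLM v x = v ⬝ᵥ x := by
  simp [dotCLM, dotProduct]

theorem vecMul_J (v : Phase N) : v ᵥ* Matrix.J (Fin N) ℝ = symp v := by
  rw [Matrix.J, Matrix.vecMul_fromBlocks]
  ext (i | i) <;> simp [symp, Matrix.vecMul_neg]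

theorem J_mulVec (v : Phase N) : Matrix.J (Fin N) ℝ *ᵥ v = -symp v := by
  rw [← vecMul_J, ← Matrix.mulVec_transpose, Matrix.J_transpose, Matrix.neg_mulVec, neg_neg]

theorem symp_dotProduct (u v : Phase N) : symp u ⬝ᵥ v = -(u ⬝ᵥ symp v) := by
  rw [← vecMul_J, ← Matrix.dotProduct_mulVec, J_mulVec, dotProduct_neg]

theorem dotProduct_symp_self (v : Phase N) : v ⬝ᵥ symp v = 0 := by
  have h := symp_dotProduct v v
  rw [dotProduct_comm] at h
  linarith

/-- The time-one flow of the Hamiltonian `c ε^a ⟨v, x⟩^(b+1) / (b+1)`; it is explicit because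
`⟨v, x⟩` is conserved. -/
noncomputable def shear (c : ℝ) (a : Fin m → ℕ) (b : ℕ) (v : Phase N) :
    Param m → Phase N → Phase N :=
  fun ε x => x + (c * (∏ i, ε i ^ a i) * dotCLM v x ^ b) • symp v

variable (c : ℝ) (a : Fin m → ℕ) (b : ℕ) (v : Phase N) (ε : Param m) (x : Phase N)

theorem contDiff_shear : ContDiff ℝ ∞ (Function.uncurry (shear c a b v)) := by
  have : ContDiff ℝ ∞ fun y : Param m × Phase N => ∏ i, y.1 i ^ a i :=
    contDiff_prod fun i _ => by fun_prop
  change ContDiff ℝ ∞ fun y : Param m × Phase N =>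
    y.2 + (c * (∏ i, y.1 i ^ a i) * dotCLM v y.2 ^ b) • symp v
  fun_prop

theorem dotCLM_shear : dotCLM v (shear c a b v ε x) = dotCLM v x := by
  rw [shear, map_add, map_smul, dotCLM_apply v (symp v), dotProduct_symp_self, smul_zero, add_zero]

theorem shear_neg_shear : shear (-c) a b v ε (shear c a b v ε x) = x := by
  rw [shear, dotCLM_shear, shear]
  simp only [neg_mul, neg_smul]
  abel

theorem hasFDerivAt_shear : HasFDerivAt (shear c a b v ε) (ContinuousLinearMap.id ℝ (Phase N) +
    (c * (∏ i, ε i ^ a i) * (b * dotCLM v x ^ (b - 1))) • (dotCLM v).smulRight (symp v)) x := by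
  have hpow : HasFDerivAt (fun x => dotCLM v x ^ b) ((b * dotCLM v x ^ (b - 1)) • dotCLM v) x := by
    simpa using (dotCLM v).hasFDerivAt.pow b (x := x)
  have hadd := (hasFDerivAt_id x).add
    ((hpow.const_mul (c * (∏ i, ε i ^ a i))).smul_const (symp v))
  refine hadd.congr_fderiv ?_
  ext y
  simp [smul_smul, mul_assoc]

theorem toMatrix'_transvection (t : ℝ) :
    LinearMap.toMatrix' ((ContinuousLinearMap.id ℝ (Phase N) +
      t • (dotCLM v).smulRight (symp v) : Phase N →L[ℝ] Phase N) : Phase N →ₗ[ℝ] Phase N) =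
      1 + t • Matrix.vecMulVec (symp v) v := by
  ext i j
  simp [LinearMap.toMatrix'_apply, dotCLM_apply, Matrix.one_apply, Pi.single_apply,
    Matrix.vecMulVec_apply, mul_comm]

theorem transvection_mem_symplecticGroup (t : ℝ) :
    1 + t • Matrix.vecMulVec (symp v) v ∈ Matrix.symplecticGroup (Fin N) ℝ := by
  have hzero : Matrix.vecMulVec (symp v) (symp v) *ᵥ v = 0 := by
    rw [Matrix.vecMulVec_mulVec, dotProduct_comm, dotProduct_symp_self, MulOpposite.op_zero,
      zero_smul]
  rw [SymplecticGroup.mem_iff]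
  simp only [Matrix.transpose_add, Matrix.transpose_one, Matrix.transpose_smul,
    Matrix.transpose_vecMulVec, Matrix.add_mul, Matrix.one_mul, Matrix.mul_add, Matrix.mul_one,
    Matrix.smul_mul, Matrix.mul_smul, Matrix.vecMulVec_mul, Matrix.mul_vecMulVec, vecMul_J]
  rw [Matrix.add_mulVec, Matrix.smul_mulVec, hzero, J_mulVec, smul_zero, add_zero,
    Matrix.neg_vecMulVec, smul_neg, add_neg_cancel_right]

theorem symplectic_shear :
    LinearMap.toMatrix' (fderiv ℝ (shear c a b v ε) x : Phase N →ₗ[ℝ] Phase N) ∈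
      Matrix.symplecticGroup (Fin N) ℝ := by
  rw [(hasFDerivAt_shear c a b v ε x).fderiv, toMatrix'_transvection]
  exact transvection_mem_symplecticGroup v _

end Shear

section Extend

variable {n : ℕ}

@[simp] theorem extend_inl_zero (z : Phase n) : extend z (Sum.inl 0) = 0 := rfl

@[simp] theorem extend_inr_zero (z : Phase n) : extend z (Sum.inr 0) = 0 := rfl

@[simp] theorem extend_inl_succ (z : Phase n) (i : Fin n) :
    extend z (Sum.inl i.succ) = z (Sum.inl i) := rfl

@[simp] theorem extend_inr_succ (z : Phase n) (i : Fin n) :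
    extend z (Sum.inr i.succ) = z (Sum.inr i) := rfl

@[simp] theorem restrict_extend (z : Phase n) : restrict (extend z) = z := by
  ext (i | i) <;> simp [restrict]

theorem symp_extend (v : Phase n) : symp (extend v) = extend (symp v) := by
  ext (i | i) <;> refine Fin.cases ?_ (fun i => ?_) i <;> simp [symp]

theorem extend_add_smul (z u : Phase n) (t : ℝ) :
    extend z + t • extend u = extend (z + t • u) := by
  ext (i | i) <;> refine Fin.cases ?_ (fun i => ?_) i <;> simp

theorem extend_zero : extend (0 : Phase n) = 0 := by
  ext (i | i) <;> refine Fin.cases ?_ (fun _ => ?_) i <;> simp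

theorem dotCLM_extend (v : Phase n) (x : Phase (n + 1)) :
    dotCLM (extend v) x = dotCLM v (restrict x) := by
  simp [dotCLM_apply, dotProduct, Fintype.sum_sum_type, Fin.sum_univ_succ, restrict]

theorem norm_restrict_le (x : Phase (n + 1)) : ‖restrict x‖ ≤ ‖x‖ :=
  (pi_norm_le_iff_of_nonneg (norm_nonneg _)).2 fun _ => norm_le_pi_norm x _

theorem norm_dropP0_le (x : Phase (n + 1)) : ‖dropP0 x‖ ≤ ‖x‖ := by
  refine (pi_norm_le_iff_of_nonneg (norm_nonneg _)).2 fun j => ?_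
  rw [dropP0, Function.update_apply]
  split_ifs
  · simp
  · exact norm_le_pi_norm x j

theorem restrict_dropP0 (x : Phase (n + 1)) : restrict (dropP0 x) = restrict x := by
  ext (i | i) <;> simp [restrict, dropP0]

theorem norm_restrict_le_dropP0 (x : Phase (n + 1)) : ‖restrict x‖ ≤ ‖dropP0 x‖ := by
  simpa only [restrict_dropP0] using norm_restrict_le (dropP0 x)

theorem restrict_sub (x y : Phase (n + 1)) : restrict (x - y) = restrict x - restrict y := rfl

theorem dropP0_sub (x y : Phase (n + 1)) : dropP0 (x - y) = dropP0 x - dropP0 y := by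
  ext j
  simp only [dropP0, Function.update_apply, Pi.sub_apply]
  split_ifs <;> simp

end Extend

/-! ### Canonical changes of variables acting polynomially -/

section PolyChange

variable {m n : ℕ}

/-- Polynomials in the parameters and in the phase-space variables of the lower-order system. -/
abbrev PolyHam (m n : ℕ) : Type := MvPolynomial (Fin m ⊕ (Fin n ⊕ Fin n)) ℝ

/-- The map of the lower-order phase space whose components are the polynomials `θ (X_j)`. -/
noncomputable def polyMap (θ : PolyHam m n →ₐ[ℝ] PolyHam m n) (ε : Param m) (z : Phase n) :
    Phase n :=
  fun j => eval (Sum.elim ε z) (θ (X (Sum.inr j)))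

/-- A globally defined canonical change of variables `Φ` with inverse `Ψ` that does not change
`q_0`, commutes with translations of `p_0`, and whose inverse acts polynomially on the lower-order
phase space, the pullback of polynomials by `Ψ` being `θ`. -/
structure PolyChange (Φ Ψ : Param m → Phase (n + 1) → Phase (n + 1))
    (θ : PolyHam m n →ₐ[ℝ] PolyHam m n) : Prop where
  smooth : ContDiff ℝ ∞ (Function.uncurry Φ)
  smooth_inv : ContDiff ℝ ∞ (Function.uncurry Ψ)
  left_inv : ∀ ε x, Ψ ε (Φ ε x) = x
  right_inv : ∀ ε x, Φ ε (Ψ ε x) = x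
  symplectic : ∀ ε x, LinearMap.toMatrix' (fderiv ℝ (Φ ε) x : Phase (n + 1) →ₗ[ℝ] Phase (n + 1)) ∈
    Matrix.symplecticGroup (Fin (n + 1)) ℝ
  apply_zero : Φ 0 0 = 0
  hasFDerivAt_zero : HasFDerivAt (Φ 0) (ContinuousLinearMap.id ℝ (Phase (n + 1))) 0
  q0 : ∀ ε x, Φ ε x (Sum.inl 0) = x (Sum.inl 0)
  p0 : ∀ ε x (t : ℝ), Ψ ε (x + t • Pi.single (Sum.inr 0) 1) =
    Ψ ε x + t • Pi.single (Sum.inr 0) 1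
  pullback : ∀ ε z, Ψ ε (extend z) = extend (polyMap θ ε z)
  pullback_par : ∀ i, θ (X (Sum.inl i)) = X (Sum.inl i)
  raises_one : Raises 1 0 θ

/-- A change of variables `Φ`, with pullback `θ` of polynomials, that fixes `(q, p) = 0` for every
parameter and is close to the identity there. -/
structure PreservesEquilibrium (Φ : Param m → Phase (n + 1) → Phase (n + 1))
    (θ : PolyHam m n →ₐ[ℝ] PolyHam m n) : Prop where
  raises_phase : Raises phaseWeight 0 θ
  sub_isBigO : (fun y : Param m × Phase (n + 1) => Φ y.1 y.2 - y.2) =O[𝓝 0]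
    fun y => ‖(y.1, dropP0 y.2)‖ * ‖restrict y.2‖

variable {Φ Ψ Φ₁ Ψ₁ Φ₂ Ψ₂ : Param m → Phase (n + 1) → Phase (n + 1)}
  {θ θ₁ θ₂ : PolyHam m n →ₐ[ℝ] PolyHam m n}

theorem PolyChange.eval_pullback (h : PolyChange Φ Ψ θ) (ε : Param m) (z : Phase n)
    (p : PolyHam m n) : eval (Sum.elim ε z) (θ p) = eval (Sum.elim ε (polyMap θ ε z)) p := by
  have key : (aeval (R := ℝ) (Sum.elim ε z : _ → ℝ)).comp θ =
      aeval (R := ℝ) (Sum.elim ε (polyMap θ ε z) : _ → ℝ) := by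
    apply MvPolynomial.algHom_ext
    rintro (i | j)
    · simp [h.pullback_par]
    · simp [polyMap]
  simpa [coe_aeval_eq_eval] using AlgHom.congr_fun key p

theorem PolyChange.id : PolyChange (fun _ x => x) (fun _ x => x) (AlgHom.id ℝ (PolyHam m n)) where
  smooth := contDiff_snd
  smooth_inv := contDiff_snd
  left_inv _ _ := rfl
  right_inv _ _ := rfl
  symplectic _ x := by
    rw [fderiv_fun_id, ContinuousLinearMap.coe_id, LinearMap.toMatrix'_id]
    exact one_mem _
  apply_zero := rfl
  hasFDerivAt_zero := hasFDerivAt_id 0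
  q0 _ _ := rfl
  p0 _ _ _ := rfl
  pullback ε z := by
    congr 1
    ext j
    simp [polyMap]
  pullback_par _ := rfl
  raises_one := Raises.id _ _

theorem PolyChange.differentiable (h : PolyChange Φ Ψ θ) (ε : Param m) :
    Differentiable ℝ (Φ ε) :=
  (h.smooth.comp (contDiff_const.prodMk contDiff_id)).differentiable (by simp)

theorem PolyChange.comp (h₁ : PolyChange Φ₁ Ψ₁ θ₁) (h₂ : PolyChange Φ₂ Ψ₂ θ₂) :
    PolyChange (fun ε x => Φ₁ ε (Φ₂ ε x)) (fun ε x => Ψ₂ ε (Ψ₁ ε x)) (θ₁.comp θ₂) where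
  smooth := h₁.smooth.comp (contDiff_fst.prodMk h₂.smooth)
  smooth_inv := h₂.smooth_inv.comp (contDiff_fst.prodMk h₁.smooth_inv)
  left_inv ε x := by rw [h₁.left_inv, h₂.left_inv]
  right_inv ε x := by rw [h₂.right_inv, h₁.right_inv]
  symplectic ε x := by
    have hcomp : fderiv ℝ (fun x => Φ₁ ε (Φ₂ ε x)) x =
        (fderiv ℝ (Φ₁ ε) (Φ₂ ε x)).comp (fderiv ℝ (Φ₂ ε) x) :=
      fderiv_comp x (h₁.differentiable ε _) (h₂.differentiable ε _)
    rw [hcomp, ContinuousLinearMap.toLinearMap_comp, LinearMap.toMatrix'_comp]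
    exact mul_mem (h₁.symplectic _ _) (h₂.symplectic _ _)
  apply_zero := by rw [h₂.apply_zero, h₁.apply_zero]
  hasFDerivAt_zero := by
    have hΦ₁ : HasFDerivAt (Φ₁ 0) (ContinuousLinearMap.id ℝ (Phase (n + 1))) (Φ₂ 0 0) := by
      rw [h₂.apply_zero]
      exact h₁.hasFDerivAt_zero
    exact hΦ₁.comp 0 h₂.hasFDerivAt_zero
  q0 ε x := by rw [h₁.q0, h₂.q0]
  p0 ε x t := by rw [h₁.p0, h₂.p0]
  pullback ε z := by
    rw [h₁.pullback, h₂.pullback]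
    congr 1
    ext j
    rw [polyMap, polyMap, AlgHom.comp_apply, h₁.eval_pullback]
  pullback_par i := by rw [AlgHom.comp_apply, h₂.pullback_par, h₁.pullback_par]
  raises_one := h₁.raises_one.comp h₂.raises_one

theorem PreservesEquilibrium.id :
    PreservesEquilibrium (fun _ x => x) (AlgHom.id ℝ (PolyHam m n)) where
  raises_phase := Raises.id _ _
  sub_isBigO := by simpa using isBigO_zero _ _

theorem norm_restrict_isBigO :
    (fun y : Param m × Phase (n + 1) => ‖restrict y.2‖) =O[𝓝 0] fun y => ‖(y.1, dropP0 y.2)‖ :=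
  IsBigO.of_norm_le fun y => by
    rw [norm_norm]
    exact (norm_restrict_le_dropP0 _).trans (norm_snd_le (y.1, dropP0 y.2))

theorem tendsto_prod_dropP0 :
    Tendsto (fun y : Param m × Phase (n + 1) => ‖(y.1, dropP0 y.2)‖) (𝓝 0) (𝓝 0) :=
  squeeze_zero (fun _ => norm_nonneg _)
    (fun y => max_le_max le_rfl (norm_dropP0_le y.2)) tendsto_norm_zero

theorem PreservesEquilibrium.sub_isBigO_restrict (h : PreservesEquilibrium Φ θ) :
    (fun y : Param m × Phase (n + 1) => Φ y.1 y.2 - y.2) =O[𝓝 0] fun y => ‖restrict y.2‖ := by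
  simpa using h.sub_isBigO.trans ((tendsto_prod_dropP0.isBigO_one ℝ).mul (isBigO_refl _ _))

theorem PreservesEquilibrium.restrict_isBigO (h : PreservesEquilibrium Φ θ) :
    (fun y : Param m × Phase (n + 1) => restrict (Φ y.1 y.2)) =O[𝓝 0]
      fun y => ‖restrict y.2‖ := by
  have hsub : (fun y : Param m × Phase (n + 1) => restrict (Φ y.1 y.2 - y.2)) =O[𝓝 0]
      fun y => ‖restrict y.2‖ :=
    (IsBigO.of_norm_le fun y => norm_restrict_le _).trans h.sub_isBigO_restrict.norm_left
  have hadd := hsub.add (isBigO_norm_right.2 (isBigO_refl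
    (fun y : Param m × Phase (n + 1) => restrict y.2) (𝓝 0)))
  simpa only [restrict_sub, sub_add_cancel] using hadd

theorem PreservesEquilibrium.dropP0_isBigO (h : PreservesEquilibrium Φ θ) :
    (fun y : Param m × Phase (n + 1) => (y.1, dropP0 (Φ y.1 y.2))) =O[𝓝 0]
      fun y => ‖(y.1, dropP0 y.2)‖ := by
  have hsub : (fun y : Param m × Phase (n + 1) => dropP0 (Φ y.1 y.2 - y.2)) =O[𝓝 0]
      fun y => ‖(y.1, dropP0 y.2)‖ :=
    ((IsBigO.of_norm_le fun y => norm_dropP0_le _).trans h.sub_isBigO_restrict.norm_left).trans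
      norm_restrict_isBigO
  have hadd := hsub.add (IsBigO.of_norm_le fun y : Param m × Phase (n + 1) =>
    norm_snd_le (y.1, dropP0 y.2))
  simp only [dropP0_sub, sub_add_cancel] at hadd
  exact (IsBigO.of_norm_le fun y : Param m × Phase (n + 1) =>
    norm_fst_le (y.1, dropP0 y.2)).prod_left hadd

theorem PreservesEquilibrium.tendsto (h : PreservesEquilibrium Φ θ) :
    Tendsto (fun y : Param m × Phase (n + 1) => (y.1, Φ y.1 y.2)) (𝓝 0) (𝓝 0) := by
  have hrestrict : Tendsto (fun y : Param m × Phase (n + 1) => ‖restrict y.2‖) (𝓝 0) (𝓝 0) :=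
    norm_restrict_isBigO.trans_tendsto tendsto_prod_dropP0
  have hsub := h.sub_isBigO_restrict.trans_tendsto hrestrict
  have hsnd : Tendsto (fun y : Param m × Phase (n + 1) => y.2) (𝓝 0) (𝓝 0) :=
    continuous_snd.tendsto 0
  have hfst : Tendsto (fun y : Param m × Phase (n + 1) => y.1) (𝓝 0) (𝓝 0) :=
    continuous_fst.tendsto 0
  have hadd := hsub.add hsnd
  simp only [sub_add_cancel, add_zero] at hadd
  exact hfst.prodMk_nhds hadd

theorem PreservesEquilibrium.comp (h₁ : PreservesEquilibrium Φ₁ θ₁)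
    (h₂ : PreservesEquilibrium Φ₂ θ₂) :
    PreservesEquilibrium (fun ε x => Φ₁ ε (Φ₂ ε x)) (θ₁.comp θ₂) where
  raises_phase := h₁.raises_phase.comp h₂.raises_phase
  sub_isBigO := by
    have houter := (h₁.sub_isBigO.comp_tendsto h₂.tendsto).trans
      (h₂.dropP0_isBigO.norm_left.mul h₂.restrict_isBigO.norm_left)
    refine (houter.add h₂.sub_isBigO).congr_left fun y => ?_
    simp

theorem eval_ridge (a : Fin m → ℕ) (v : Phase n) (b : ℕ) (ε : Param m) (z : Phase n) :
    eval (Sum.elim ε z) (ridge a v b) = (∏ i, ε i ^ a i) * dotCLM v z ^ b := by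
  simp [ridge, linForm, dotCLM_apply, dotProduct]

/-- The pullback of polynomials by the shear generated by `c ε^a ⟨v, z⟩^(b + 1) / (b + 1)`. -/
noncomputable def shearHom (c : ℝ) (a : Fin m → ℕ) (b : ℕ) (v : Phase n) :
    PolyHam m n →ₐ[ℝ] PolyHam m n :=
  aeval (Sum.elim (fun i => X (Sum.inl i)) fun j => X (Sum.inr j) + (symp v j * c) • ridge a v b)

variable (c : ℝ) (a : Fin m → ℕ) (b : ℕ) (v : Phase n)

theorem shearHom_X_inl (i : Fin m) : shearHom c a b v (X (Sum.inl i)) = X (Sum.inl i) := by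
  simp [shearHom]

theorem shearHom_X_inr (j : Fin n ⊕ Fin n) :
    shearHom c a b v (X (Sum.inr j)) = X (Sum.inr j) + (symp v j * c) • ridge a v b := by
  simp [shearHom]

theorem raises_shearHom {a : Fin m → ℕ} {b : ℕ} {v : Phase n} {wt : Fin m ⊕ (Fin n ⊕ Fin n) → ℕ}
    {d : ℕ} (hwt : ∀ j, wt (Sum.inr j) = 1) (h : ridge a v b ∈ filtration ℝ wt (1 + d)) :
    Raises wt d (shearHom c a b v) := by
  refine Raises.of_X ?_
  rintro (i | j)
  · rw [shearHom_X_inl, sub_self]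
    exact zero_mem _
  · rw [shearHom_X_inr, add_sub_cancel_left, hwt]
    exact Submodule.smul_mem _ _ h

theorem prod_zero_pow_eq_zero {a : Fin m → ℕ} (ha : ∑ i, a i ≠ 0) :
    ∏ i, (0 : Param m) i ^ a i = 0 := by
  obtain ⟨i, hi, hai⟩ := Finset.exists_ne_zero_of_sum_ne_zero ha
  exact Finset.prod_eq_zero hi (by simp [hai])

variable {a b}

theorem polyChange_shear (hw : 2 ≤ 2 * ∑ i, a i + b) :
    PolyChange (shear (-c) a b (extend v)) (shear c a b (extend v)) (shearHom c a b v) where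
  smooth := contDiff_shear _ _ _ _
  smooth_inv := contDiff_shear _ _ _ _
  left_inv ε x := by simpa using shear_neg_shear (-c) a b (extend v) ε x
  right_inv ε x := shear_neg_shear c a b (extend v) ε x
  symplectic ε x := symplectic_shear _ _ _ _ _ _
  apply_zero := by
    have h : (∏ i, (0 : Param m) i ^ a i) * dotCLM (extend v) 0 ^ b = 0 := by
      by_cases ha : ∑ i, a i = 0
      · rw [map_zero, zero_pow (by omega), mul_zero]
      · rw [prod_zero_pow_eq_zero ha, zero_mul]
    simp only [shear, mul_assoc, h, mul_zero, zero_smul, add_zero]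
  hasFDerivAt_zero := by
    refine (hasFDerivAt_shear (-c) a b (extend v) 0 0).congr_fderiv ?_
    have h : (∏ i, (0 : Param m) i ^ a i) * (b * dotCLM (extend v) 0 ^ (b - 1)) = 0 := by
      by_cases ha : ∑ i, a i = 0
      · rw [map_zero, zero_pow (by omega), mul_zero, mul_zero]
      · rw [prod_zero_pow_eq_zero ha, zero_mul]
    rw [mul_assoc, h, mul_zero, zero_smul, add_zero]
  q0 ε x := by simp [shear, symp_extend]
  p0 ε x t := by
    have h : dotCLM (extend v) (Pi.single (Sum.inr 0) 1) = 0 := by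
      rw [dotCLM_apply, dotProduct_single_one, extend_inr_zero]
    simp only [shear, map_add, map_smul, h, smul_zero, add_zero]
    abel
  pullback ε z := by
    rw [shear, symp_extend, extend_add_smul, dotCLM_extend, restrict_extend]
    congr 1
    ext j
    rw [polyMap, shearHom_X_inr, map_add, smul_eval, eval_X, eval_ridge, Sum.elim_inr, Pi.add_apply,
      Pi.smul_apply, smul_eq_mul]
    ring
  pullback_par i := shearHom_X_inl _ _ _ _ _
  raises_one := raises_shearHom c (fun _ => rfl)
    (filtration_antitone _ (by omega) (ridge_mem_filtration_one a v b))

theorem shear_extend_sub (ε : Param m) (x : Phase (n + 1)) :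
    shear c a b (extend v) ε x - x =
      (c * eval (Sum.elim ε (restrict x)) (ridge a v b)) • symp (extend v) := by
  rw [shear, add_sub_cancel_left, eval_ridge, dotCLM_extend, mul_assoc]

theorem preservesEquilibrium_shear (hb : 1 ≤ b) (hw : 2 ≤ 2 * ∑ i, a i + b) :
    PreservesEquilibrium (shear (-c) a b (extend v)) (shearHom c a b v) where
  raises_phase := raises_shearHom c (fun _ => rfl)
    (filtration_antitone _ hb (ridge_mem_filtration_phaseWeight a v b))
  sub_isBigO := by
    have hridge : (fun y : Param m × Phase n => eval (Sum.elim y.1 y.2) (ridge a v b)) =O[𝓝 0]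
        fun y => ‖y.2‖ ^ 1 * ‖y‖ ^ 1 :=
      isBigO_eval (filtration_antitone _ hb (ridge_mem_filtration_phaseWeight a v b))
        (filtration_antitone _ (by omega) (ridge_mem_filtration_one a v b))
    have htendsto : Tendsto (fun y : Param m × Phase (n + 1) => (y.1, restrict y.2))
        (𝓝 0) (𝓝 0) :=
      (continuous_fst.prodMk (continuous_pi fun _ =>
        (continuous_apply _).comp continuous_snd)).tendsto 0
    have hsmul := ((hridge.comp_tendsto htendsto).const_mul_left (-c)).smul
      (isBigO_const_const (symp (extend v)) (one_ne_zero (α := ℝ))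
        (𝓝 (0 : Param m × Phase (n + 1))))
    simp only [shear_extend_sub]
    refine hsmul.trans (IsBigO.of_norm_le fun y => ?_)
    simp only [Function.comp_apply, pow_one, smul_eq_mul, mul_one, norm_mul, norm_norm]
    rw [mul_comm]
    exact mul_le_mul_of_nonneg_right (max_le_max le_rfl (norm_restrict_le_dropP0 _))
      (norm_nonneg _)

end PolyChange

/-! ### Quadratic Hamiltonians -/

section QuadraticForm

variable {σ κ : Type*}

theorem weight_one_le_weight_parWeight (s : σ ⊕ κ →₀ ℕ) :
    Finsupp.weight (1 : σ ⊕ κ → ℕ) s ≤ Finsupp.weight parWeight s := by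
  induction s using Finsupp.induction_linear with
  | zero => simp
  | add s t hs ht => simpa only [map_add] using add_le_add hs ht
  | single i b =>
    rcases i with i | j
    · simpa [Finsupp.weight_single, parWeight] using Nat.le_mul_of_pos_right b two_pos
    · simp [Finsupp.weight_single, parWeight]

theorem exists_eq_single_add_single {s : σ ⊕ κ →₀ ℕ}
    (hone : 2 ≤ Finsupp.weight (1 : σ ⊕ κ → ℕ) s) (hpar : Finsupp.weight parWeight s = 2) :
    ∃ i j, s = Finsupp.single (Sum.inr i) 1 + Finsupp.single (Sum.inr j) 1 := by
  classical
  have hcard : (Finsupp.toMultiset s).card = 2 := by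
    have hdegree : (Finsupp.toMultiset s).card = Finsupp.weight (1 : σ ⊕ κ → ℕ) s := by
      simp [Finsupp.card_toMultiset, Finsupp.weight_apply, Function.id_def]
    have hle := weight_one_le_weight_parWeight s
    omega
  obtain ⟨x, y, hxy⟩ := Multiset.card_eq_two.1 hcard
  have hs : s = Finsupp.single x 1 + Finsupp.single y 1 := by
    rw [← Finsupp.toMultiset_toFinsupp s, hxy]
    simp [Multiset.insert_eq_cons, ← Multiset.singleton_add]
  subst hs
  rcases x with x | x <;> rcases y with y | y
  · simp [Finsupp.weight_single, parWeight] at hpar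
  · simp [Finsupp.weight_single, parWeight] at hpar
  · simp [Finsupp.weight_single, parWeight] at hpar
  · exact ⟨x, y, rfl⟩

variable [Fintype κ]

/-- The quadratic form `½ ⟨z, B z⟩` as a polynomial. -/
noncomputable def quadForm (σ : Type*) {κ : Type*} [Fintype κ] (B : Matrix κ κ ℝ) :
    MvPolynomial (σ ⊕ κ) ℝ :=
  (1 / 2 : ℝ) • ((fun j => X (Sum.inr j)) ⬝ᵥ B.map C *ᵥ fun j => X (Sum.inr j))

theorem quadForm_add (B B' : Matrix κ κ ℝ) :
    quadForm σ (B + B') = quadForm σ B + quadForm σ B' := by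
  simp only [quadForm, Matrix.map_add C fun _ _ => C_add, Matrix.add_mulVec, dotProduct_add,
    smul_add]

theorem quadForm_single [DecidableEq κ] (i j : κ) (c : ℝ) :
    quadForm σ (Matrix.single i j c) =
      (c / 2) • (X (Sum.inr i) * X (Sum.inr j) : MvPolynomial (σ ⊕ κ) ℝ) := by
  rw [quadForm, Matrix.map_single, Matrix.single_mulVec, ← Pi.single, dotProduct_single,
    ← smul_eq_C_mul, mul_smul_comm, smul_smul, one_div_mul_eq_div]

theorem quadForm_mem_filtration_phaseWeight (B : Matrix κ κ ℝ) :
    quadForm σ B ∈ filtration ℝ phaseWeight 2 := by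
  have hX : ∀ j : κ, (X (Sum.inr j) : MvPolynomial (σ ⊕ κ) ℝ) ∈ filtration ℝ phaseWeight 1 :=
    fun j => X_mem_filtration phaseWeight (Sum.inr j)
  simp only [quadForm, dotProduct, Matrix.mulVec, Matrix.map_apply, ← smul_eq_C_mul]
  exact Submodule.smul_mem _ _ <| sum_mem fun i _ => mul_mem_filtration (hX i) <|
    sum_mem fun j _ => Submodule.smul_mem _ _ (hX j)

theorem eval_quadForm (B : Matrix κ κ ℝ) (ε : σ → ℝ) (z : κ → ℝ) :
    eval (Sum.elim ε z) (quadForm σ B) = (1 / 2) * (z ⬝ᵥ B *ᵥ z) := by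
  simp [quadForm, dotProduct, Matrix.mulVec]

theorem monomial_eq_quadForm [DecidableEq κ] (i j : κ) (c : ℝ) :
    monomial (Finsupp.single (Sum.inr i) 1 + Finsupp.single (Sum.inr j) 1) c =
      quadForm σ (Matrix.single i j c + Matrix.single j i c) := by
  have hmon : (monomial (Finsupp.single (Sum.inr i) 1 + Finsupp.single (Sum.inr j) 1) c :
      MvPolynomial (σ ⊕ κ) ℝ) = c • (X (Sum.inr i) * X (Sum.inr j)) := by
    rw [X, X, monomial_mul, smul_monomial, mul_one, smul_eq_mul, mul_one]
  rw [hmon, quadForm_add, quadForm_single, quadForm_single, mul_comm (X (Sum.inr j)), ← add_smul,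
    add_halves]

theorem map_quadForm (θ : MvPolynomial (σ ⊕ κ) ℝ →ₐ[ℝ] MvPolynomial (σ ⊕ κ) ℝ)
    (B : Matrix κ κ ℝ) : θ (quadForm σ B) =
      (1 / 2 : ℝ) • ((fun j => θ (X (Sum.inr j))) ⬝ᵥ B.map C *ᵥ fun j => θ (X (Sum.inr j))) := by
  have hC : ∀ x : ℝ, θ (C x) = C x := θ.commutes
  simp only [quadForm, dotProduct, Matrix.mulVec, Matrix.map_apply, map_smul, map_sum, map_mul, hC]

theorem add_smul_dotProduct_mulVec_add_smul {R : Type*} [CommRing R] {M : Matrix κ κ R}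
    (hM : M.IsSymm) (z u : κ → R) (t : R) :
    (z + t • u) ⬝ᵥ M *ᵥ (z + t • u) =
      z ⬝ᵥ M *ᵥ z + 2 * t * (u ⬝ᵥ M *ᵥ z) + t ^ 2 * (u ⬝ᵥ M *ᵥ u) := by
  have hcross : z ⬝ᵥ M *ᵥ u = u ⬝ᵥ M *ᵥ z := by
    rw [Matrix.dotProduct_mulVec, ← Matrix.mulVec_transpose, hM, dotProduct_comm]
  simp only [Matrix.mulVec_add, Matrix.mulVec_smul, add_dotProduct, dotProduct_add,
    smul_dotProduct, dotProduct_smul, hcross, smul_eq_mul]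
  ring

theorem exists_sub_quadForm_mem_filtration {p : MvPolynomial (σ ⊕ κ) ℝ}
    (hp : p ∈ filtration ℝ 1 2) :
    ∃ B : Matrix κ κ ℝ, B.IsSymm ∧ p - quadForm σ B ∈ filtration ℝ parWeight 3 := by
  classical
  have hpar : p ∈ filtration ℝ parWeight 2 := fun s hs =>
    (hp hs).trans (weight_one_le_weight_parWeight s)
  suffices h : ∃ B : Matrix κ κ ℝ,
      B.IsSymm ∧ weightedHomogeneousComponent parWeight 2 p = quadForm σ B by
    obtain ⟨B, hB, hpB⟩ := h
    exact ⟨B, hB, hpB ▸ sub_weightedHomogeneousComponent_mem_filtration hpar⟩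
  set q := weightedHomogeneousComponent parWeight 2 p
  rw [q.as_sum]
  refine Finset.sum_induction _ (fun q => ∃ B : Matrix κ κ ℝ, B.IsSymm ∧ q = quadForm σ B)
    ?_ ⟨0, Matrix.isSymm_zero, by simp [quadForm]⟩ fun s hs => ?_
  · rintro _ _ ⟨B, hB, rfl⟩ ⟨B', hB', rfl⟩
    exact ⟨B + B', hB.add hB', (quadForm_add B B').symm⟩
  · obtain ⟨i, j, rfl⟩ := exists_eq_single_add_single
      (weightedHomogeneousComponent_mem_restrictSupport _ 2 hp hs)
      (weightedHomogeneousComponent_isWeightedHomogeneous 2 p (mem_support_iff.1 hs))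
    refine ⟨_, ?_, monomial_eq_quadForm i j _⟩
    rw [Matrix.IsSymm, Matrix.transpose_add, Matrix.transpose_single, Matrix.transpose_single,
      add_comm]

theorem pderiv_linForm (v : κ → ℝ) (i : κ) :
    pderiv (Sum.inr i) (linForm σ v) = C (v i) := by
  classical
  simp [linForm, pderiv_X, Pi.single_apply]

variable [Fintype σ]

theorem pderiv_ridge (a : σ → ℕ) (v : κ → ℝ) (b : ℕ) (i : κ) :
    pderiv (Sum.inr i) (ridge a v (b + 1)) = (v i * (b + 1)) • ridge a v b := by
  classical
  have hpar : pderiv (R := ℝ) (Sum.inr i) (∏ l, X (Sum.inl l : σ ⊕ κ) ^ a l) = 0 := by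
    refine Finset.prod_induction _ (fun q => pderiv (Sum.inr i) q = 0) ?_ ?_ ?_
    · intro p q hp hq
      rw [Derivation.leibniz, hp, hq, smul_zero, smul_zero, add_zero]
    · exact pderiv_one
    · intro l _
      rw [Derivation.leibniz_pow, pderiv_X_of_ne Sum.inl_ne_inr, smul_zero, smul_zero]
  rw [ridge, Derivation.leibniz, hpar, Derivation.leibniz_pow, pderiv_linForm, ridge]
  simp only [add_tsub_cancel_right, smul_eq_mul, nsmul_eq_mul, Nat.cast_add, Nat.cast_one,
    mul_zero, add_zero, smul_eq_C_mul, C_mul, C_add, map_natCast, C_1]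
  ring

theorem derivAlong_ridge (L : Matrix κ κ ℝ) (a : σ → ℕ) (v : κ → ℝ) (b : ℕ) :
    derivAlong L (ridge a v (b + 1)) = (b + 1 : ℝ) • (linForm σ (v ᵥ* L) * ridge a v b) := by
  simp only [derivAlong_apply, pderiv_ridge, linForm, Matrix.vecMul, dotProduct]
  rw [Finset.sum_comm]
  simp only [map_sum, Finset.sum_mul, Finset.smul_sum, smul_eq_C_mul, C_mul]
  refine Finset.sum_congr rfl fun j _ => Finset.sum_congr rfl fun i _ => ?_
  ring

end QuadraticForm

/-! ### Normalisation of polynomial Hamiltonians -/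

section Normalisation

variable {m n : ℕ} {B : Matrix (Fin n ⊕ Fin n) (Fin n ⊕ Fin n) ℝ}

/-- The matrix of the linear Hamiltonian vector field of `½ ⟨z, B z⟩`. -/
def hamMat (B : Matrix (Fin n ⊕ Fin n) (Fin n ⊕ Fin n) ℝ) :
    Matrix (Fin n ⊕ Fin n) (Fin n ⊕ Fin n) ℝ :=
  Matrix.of fun i j => symp (B.col j) i

theorem vecMul_hamMat (B : Matrix (Fin n ⊕ Fin n) (Fin n ⊕ Fin n) ℝ) (v : Phase n) :
    v ᵥ* hamMat B = -(symp v ᵥ* B) := by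
  ext j
  have h : symp (B.col j) ⬝ᵥ v = -(B.col j ⬝ᵥ symp v) := symp_dotProduct _ _
  rw [dotProduct_comm, dotProduct_comm (B.col j)] at h
  exact h

theorem shearHom_quadForm (hB : B.IsSymm) (c : ℝ) (a : Fin m → ℕ) (b : ℕ) (v : Phase n) :
    shearHom c a b v (quadForm (Fin m) B) = quadForm (Fin m) B +
      c • (linForm (Fin m) (symp v ᵥ* B) * ridge a v b) +
      (c ^ 2 / 2 * (symp v ⬝ᵥ B *ᵥ symp v)) • ridge a v b ^ 2 := by
  set Z : Fin n ⊕ Fin n → PolyHam m n := fun j => X (Sum.inr j) with hZ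
  set u : Fin n ⊕ Fin n → PolyHam m n := fun j => C (symp v j) with hu
  have hshear : (fun j => shearHom c a b v (X (Sum.inr j))) = Z + (C c * ridge a v b) • u := by
    ext1 j
    simp only [hZ, hu, shearHom_X_inr, Pi.add_apply, Pi.smul_apply, smul_eq_C_mul, C_mul,
      smul_eq_mul]
    ring
  have hlin : linForm (Fin m) (symp v ᵥ* B) = u ⬝ᵥ B.map C *ᵥ Z := by
    rw [Matrix.dotProduct_mulVec]
    simp only [linForm, dotProduct, Matrix.vecMul, hu, hZ, map_sum, map_mul, Matrix.map_apply]
  have hquad : C (symp v ⬝ᵥ B *ᵥ symp v) = u ⬝ᵥ B.map C *ᵥ u := by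
    simp only [dotProduct, Matrix.mulVec, hu, map_sum, map_mul, Matrix.map_apply]
  have htwo : (C (1 / 2) * 2 : PolyHam m n) = 1 := by
    rw [← map_ofNat C 2, ← C_mul, one_div_mul_cancel two_ne_zero, C_1]
  rw [map_quadForm, hshear, add_smul_dotProduct_mulVec_add_smul (hB.map C), hlin, quadForm]
  simp only [smul_eq_C_mul, C_mul, hquad, div_eq_mul_one_div (c ^ 2), C_pow]
  linear_combination (C c * ridge a v b * (u ⬝ᵥ B.map C *ᵥ Z)) * htwo

theorem shearHom_quadForm_sub_add_derivAlong_mem_filtration (hB : B.IsSymm) (c : ℝ) {a : Fin m → ℕ}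
    {b : ℕ} (v : Phase n) (hw : 2 ≤ 2 * ∑ i, a i + b) :
    shearHom (c * (b + 1)) a b v (quadForm (Fin m) B) - quadForm (Fin m) B +
        derivAlong (hamMat B) (c • ridge a v (b + 1)) ∈
      filtration ℝ parWeight (2 * ∑ i, a i + (b + 1) + 1) := by
  have hderiv : derivAlong (hamMat B) (c • ridge a v (b + 1)) =
      -((c * (b + 1)) • (linForm (Fin m) (symp v ᵥ* B) * ridge a v b)) := by
    rw [map_smul, derivAlong_ridge, vecMul_hamMat, smul_smul, ← smul_neg, ← neg_mul]
    congr 2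
    simp [linForm]
  rw [shearHom_quadForm hB, hderiv, add_sub_right_comm, add_sub_cancel_left, add_neg_cancel_comm]
  have hridge := mem_filtration_of_isWeightedHomogeneous (ridge_isWeightedHomogeneous a v b)
  rw [sq (ridge a v b)]
  refine Submodule.smul_mem _ _ (filtration_antitone _ ?_ (mul_mem_filtration hridge hridge))
  omega

theorem exists_polyChange_of_mem_span_ridgeSet (hB : B.IsSymm) {w r : ℕ} (hw : 3 ≤ w)
    (hr : 1 ≤ r) {S : PolyHam m n} (hS : S ∈ Submodule.span ℝ (ridgeSet w r)) :
    ∃ (Φ Ψ : Param m → Phase (n + 1) → Phase (n + 1)) (θ : PolyHam m n →ₐ[ℝ] PolyHam m n),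
      PolyChange Φ Ψ θ ∧ (2 ≤ r → PreservesEquilibrium Φ θ) ∧ Raises parWeight (w - 2) θ ∧
      θ (quadForm _ B) - quadForm _ B + derivAlong (hamMat B) S ∈
        filtration ℝ parWeight (w + 1) := by
  induction hS using Submodule.closure_induction with
  | zero =>
    exact ⟨_, _, _, PolyChange.id, fun _ => PreservesEquilibrium.id, Raises.id _ _, by simp⟩
  | add S₁ S₂ _ hS₂ ih₁ ih₂ =>
    obtain ⟨Φ₁, Ψ₁, θ₁, hchange₁, heq₁, hraises₁, hquad₁⟩ := ih₁
    obtain ⟨Φ₂, Ψ₂, θ₂, hchange₂, heq₂, hraises₂, hquad₂⟩ := ih₂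
    refine ⟨_, _, _, hchange₁.comp hchange₂, fun h => (heq₁ h).comp (heq₂ h),
      hraises₁.comp hraises₂, ?_⟩
    have hS₂w : derivAlong (hamMat B) S₂ ∈ filtration ℝ parWeight w :=
      mem_filtration_of_isWeightedHomogeneous <| derivAlong_isWeightedHomogeneous _ (fun _ => rfl)
        (isWeightedHomogeneous_of_mem_span_ridgeSet hS₂)
    have hsplit : (θ₁.comp θ₂) (quadForm _ B) - quadForm _ B + derivAlong (hamMat B) (S₁ + S₂) =
        θ₁ (θ₂ (quadForm _ B) - quadForm _ B + derivAlong (hamMat B) S₂) +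
        (θ₁ (quadForm _ B) - quadForm _ B + derivAlong (hamMat B) S₁) -
        (θ₁ (derivAlong (hamMat B) S₂) - derivAlong (hamMat B) S₂) := by
      simp only [AlgHom.comp_apply, map_add, map_sub]
      ring
    rw [hsplit]
    exact sub_mem (add_mem (hraises₁.map_mem hquad₂) hquad₁)
      (filtration_antitone _ (by omega) (hraises₁ hS₂w))
  | smul_mem c S hS =>
    obtain ⟨a, v, b, hrb, rfl, rfl⟩ := hS
    obtain ⟨b, rfl⟩ := Nat.exists_eq_add_of_le' (hr.trans hrb)
    have hab : 2 ≤ 2 * ∑ i, a i + b := by omega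
    refine ⟨_, _, _, polyChange_shear (c * (b + 1)) v hab,
      fun h => preservesEquilibrium_shear _ v (by omega) hab,
      raises_shearHom _ (fun _ => rfl) ?_,
      shearHom_quadForm_sub_add_derivAlong_mem_filtration hB c v hab⟩
    exact filtration_antitone _ (by omega)
      (mem_filtration_of_isWeightedHomogeneous (ridge_isWeightedHomogeneous a v b))

theorem exists_polyChange_of_isWeightedHomogeneous (hB : B.IsSymm) {w : ℕ} (hw : 3 ≤ w)
    {F : PolyHam m n} (hF : IsWeightedHomogeneous parWeight F w) :
    ∃ (Φ Ψ : Param m → Phase (n + 1) → Phase (n + 1)) (θ : PolyHam m n →ₐ[ℝ] PolyHam m n)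
      (G : PolyHam m n), PolyChange Φ Ψ θ ∧ Raises parWeight (w - 2) θ ∧
      IsWeightedHomogeneous parWeight G w ∧ derivAlong (hamMat B)ᵀ G = 0 ∧
      θ (quadForm _ B) - quadForm _ B + (F - G) ∈ filtration ℝ parWeight (w + 1) ∧
      (F ∈ filtration ℝ phaseWeight 2 →
        PreservesEquilibrium Φ θ ∧ G ∈ filtration ℝ phaseWeight 2) := by
  obtain ⟨r, hr, hrF, hr₂⟩ : ∃ r, 1 ≤ r ∧ derivAlong (hamMat B)ᵀ F ∈ filtration ℝ phaseWeight r ∧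
      (F ∈ filtration ℝ phaseWeight 2 → r = 2) := by
    by_cases h : F ∈ filtration ℝ phaseWeight 2
    · exact ⟨2, one_le_two, derivAlong_mem_filtration_phaseWeight _ h, fun _ => rfl⟩
    · exact ⟨1, le_rfl, derivAlong_mem_filtration_phaseWeight_one _ _, fun h' => absurd h' h⟩
  obtain ⟨S, hS, hSF⟩ := exists_derivAlong_transpose_sub_eq_zero (hamMat B) hF hrF
  obtain ⟨Φ, Ψ, θ, hchange, heq, hraises, hquad⟩ :=
    exists_polyChange_of_mem_span_ridgeSet hB hw hr hS
  have hLS : IsWeightedHomogeneous parWeight (derivAlong (hamMat B) S) w :=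
    derivAlong_isWeightedHomogeneous _ (fun _ => rfl)
      (isWeightedHomogeneous_of_mem_span_ridgeSet hS)
  refine ⟨Φ, Ψ, θ, F - derivAlong (hamMat B) S, hchange, hraises,
    (weightedHomogeneousSubmodule ℝ parWeight w).sub_mem hF hLS, hSF, by simpa using hquad,
    fun hF₂ => ?_⟩
  obtain rfl := hr₂ hF₂
  exact ⟨heq le_rfl, sub_mem hF₂
    (derivAlong_mem_filtration_phaseWeight _ (mem_filtration_of_mem_span_ridgeSet hS))⟩

theorem exists_polyChange_sub_mem_filtration_parWeight (hB : B.IsSymm) {p : PolyHam m n}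
    (hp : p - quadForm _ B ∈ filtration ℝ parWeight 3) (w : ℕ) :
    ∃ (Φ Ψ : Param m → Phase (n + 1) → Phase (n + 1)) (θ : PolyHam m n →ₐ[ℝ] PolyHam m n)
      (N : PolyHam m n), PolyChange Φ Ψ θ ∧ N ∈ filtration ℝ parWeight 3 ∧
      derivAlong (hamMat B)ᵀ N = 0 ∧ θ p - quadForm _ B - N ∈ filtration ℝ parWeight (w + 3) ∧
      (p ∈ filtration ℝ phaseWeight 2 →
        PreservesEquilibrium Φ θ ∧ N ∈ filtration ℝ phaseWeight 2) := by
  induction w with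
  | zero =>
    exact ⟨_, _, _, 0, PolyChange.id, zero_mem _, map_zero _, by simpa using hp,
      fun _ => ⟨PreservesEquilibrium.id, zero_mem _⟩⟩
  | succ w ih =>
    obtain ⟨Φ, Ψ, θ, N, hchange, hN, hNL, hR, hphase⟩ := ih
    set R := θ p - quadForm _ B - N with hRdef
    set F := weightedHomogeneousComponent parWeight (w + 3) R
    have hRF : R - F ∈ filtration ℝ parWeight (w + 3 + 1) :=
      sub_weightedHomogeneousComponent_mem_filtration hR
    obtain ⟨Φ', Ψ', θ', G, hchange', hraises, hG, hGL, hquad, hphase'⟩ :=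
      exists_polyChange_of_isWeightedHomogeneous hB (Nat.le_add_left 3 w)
        (weightedHomogeneousComponent_isWeightedHomogeneous (w + 3) R)
    refine ⟨_, _, _, N + G, hchange'.comp hchange, add_mem hN ?_, ?_, ?_, fun hp₂ => ?_⟩
    · exact filtration_antitone _ (by omega) (mem_filtration_of_isWeightedHomogeneous hG)
    · rw [map_add, hNL, hGL, add_zero]
    · have hsplit : (θ'.comp θ) p - quadForm _ B - (N + G) =
          (θ' (quadForm _ B) - quadForm _ B + (F - G)) + (θ' N - N) + (θ' R - R) + (R - F) := by
        have hθp : θ p = quadForm _ B + N + R := by rw [hRdef]; ring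
        rw [AlgHom.comp_apply, hθp, map_add, map_add]
        ring
      rw [hsplit, Nat.add_right_comm]
      exact add_mem (add_mem (add_mem hquad (filtration_antitone _ (by omega) (hraises hN)))
        (filtration_antitone _ (by omega) (hraises hR))) hRF
    · obtain ⟨heq, hN₂⟩ := hphase hp₂
      have hR₂ : R ∈ filtration ℝ phaseWeight 2 :=
        sub_mem (sub_mem (heq.raises_phase.map_mem hp₂) (quadForm_mem_filtration_phaseWeight B)) hN₂
      obtain ⟨heq', hG₂⟩ := hphase' (weightedHomogeneousComponent_mem_restrictSupport _ _ hR₂)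
      exact ⟨heq'.comp heq, add_mem hN₂ hG₂⟩

theorem exists_polyChange_sub_mem_filtration_one (hB : B.IsSymm) {p : PolyHam m n}
    (hp : p - quadForm _ B ∈ filtration ℝ parWeight 3) (k : ℕ) :
    ∃ (Φ Ψ : Param m → Phase (n + 1) → Phase (n + 1)) (θ : PolyHam m n →ₐ[ℝ] PolyHam m n)
      (N : PolyHam m n), PolyChange Φ Ψ θ ∧ N.totalDegree ≤ k + 1 ∧
      N ∈ filtration ℝ parWeight 3 ∧ derivAlong (hamMat B)ᵀ N = 0 ∧
      θ p - quadForm _ B - N ∈ filtration ℝ 1 (k + 2) ∧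
      (p ∈ filtration ℝ phaseWeight 2 →
        PreservesEquilibrium Φ θ ∧ N ∈ filtration ℝ phaseWeight 2) := by
  obtain ⟨Φ, Ψ, θ, N, hchange, hN, hNL, hR, hphase⟩ :=
    exists_polyChange_sub_mem_filtration_parWeight hB hp (2 * k)
  have hR₁ : θ p - quadForm _ B - N ∈ filtration ℝ 1 (k + 2) := fun s hs => by
    have hs : 2 * k + 3 ≤ Finsupp.weight parWeight s := hR hs
    rw [weight_parWeight] at hs
    rw [Set.mem_ofPred_eq, weight_one]
    omega
  have hcomponent : ∀ A : Set (Fin m ⊕ (Fin n ⊕ Fin n) →₀ ℕ), N ∈ restrictSupport ℝ A →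
      ∑ i ∈ Finset.range (k + 2), weightedHomogeneousComponent 1 i N ∈ restrictSupport ℝ A :=
    fun A hA => sum_mem fun i _ => weightedHomogeneousComponent_mem_restrictSupport 1 i hA
  refine ⟨Φ, Ψ, θ, ∑ i ∈ Finset.range (k + 2), weightedHomogeneousComponent 1 i N, hchange,
    ?_, hcomponent _ hN, ?_, ?_, fun hp₂ => (hphase hp₂).imp_right (hcomponent _)⟩
  · refine totalDegree_finsetSum_le fun i hi => ?_
    exact (IsHomogeneous.totalDegree_le
      (weightedHomogeneousComponent_isWeightedHomogeneous i N)).trans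
        (Nat.le_of_lt_succ (Finset.mem_range.1 hi))
  · rw [map_sum]
    refine Finset.sum_eq_zero fun i _ => ?_
    rw [derivAlong_weightedHomogeneousComponent _ fun _ => rfl, hNL, map_zero]
  · rw [← sub_add_sub_cancel _ N]
    exact add_mem hR₁ (sub_sum_weightedHomogeneousComponent_mem_filtration 1 (k + 2) N)

end Normalisation

/-! ### Recovering derivatives from asymptotic expansions -/

section Order

variable {E F : Type*} [NormedAddCommGroup E]

theorem norm_pow_isBigO_norm_pow {a b : ℕ} (h : a ≤ b) :
    (fun x : E => ‖x‖ ^ b) =O[𝓝 0] fun x => ‖x‖ ^ a := by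
  refine IsBigO.of_bound 1 ?_
  filter_upwards [Metric.ball_mem_nhds (0 : E) one_pos] with x hx
  rw [norm_pow, norm_pow, norm_norm, one_mul]
  exact pow_le_pow_of_le_one (norm_nonneg _) (mem_ball_zero_iff.1 hx).le h

theorem norm_pow_isLittleO_norm_pow {a b : ℕ} (h : a < b) :
    (fun x : E => ‖x‖ ^ b) =o[𝓝 0] fun x => ‖x‖ ^ a :=
  (isLittleO_pow_pow (𝕜 := ℝ) h).comp_tendsto tendsto_norm_zero

variable [NormedSpace ℝ E] [NormedAddCommGroup F] [NormedSpace ℝ F]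

theorem eq_zero_of_isLittleO_norm_pow {q : E → F} {r : ℕ}
    (hq : ∀ (t : ℝ) z, q (t • z) = t ^ r • q z) (h : q =o[𝓝 0] fun z => ‖z‖ ^ r) (z : E) :
    q z = 0 := by
  have hline : Tendsto (fun t : ℝ => t • z) (𝓝[≠] 0) (𝓝 0) := by
    have hcont : Continuous fun t : ℝ => t • z := by fun_prop
    exact (hcont.tendsto' 0 0 (zero_smul ℝ z)).mono_left nhdsWithin_le_nhds
  have hscaled := ((isBigO_refl (fun t : ℝ => (t ^ r)⁻¹) (𝓝[≠] 0)).smul_isLittleO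
    (h.comp_tendsto hline)).norm_right
  have hconst : (fun _ : ℝ => q z) =o[𝓝[≠] 0] fun _ => ‖z‖ ^ r := by
    refine hscaled.congr' ?_ ?_ <;> filter_upwards [self_mem_nhdsWithin] with t ht
    · rw [Function.comp_apply, hq, inv_smul_smul₀ (pow_ne_zero r ht)]
    · have htr : ‖t‖ ^ r ≠ 0 := pow_ne_zero r (norm_ne_zero_iff.2 ht)
      rw [Function.comp_apply, norm_smul, norm_inv, norm_pow, norm_pow, norm_norm, norm_smul,
        mul_pow, inv_mul_cancel_left₀ htr]
  exact isLittleO_const_const_iff.1 hconst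

theorem isLittleO_sub_fderiv_fderiv {f : E → ℝ} (hf : ContDiffAt ℝ 2 f 0)
    (hcrit : fderiv ℝ f 0 = 0) :
    (fun y => f y - f 0 - (1 / 2) * fderiv ℝ (fderiv ℝ f) 0 y y) =o[𝓝 0] fun y => ‖y‖ ^ 2 := by
  set A := fderiv ℝ (fderiv ℝ f) 0
  have hsymm : ∀ u v, A u v = A v u := fun u v => hf.isSymmSndFDerivAt (by simp) u v
  have hA' : HasFDerivAt (fderiv ℝ f) A 0 :=
    ((hf.fderiv_right (m := 1) (by norm_num)).differentiableAt one_ne_zero).hasFDerivAt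
  have hlittle : (fun y => fderiv ℝ f y - A y) =o[𝓝 0] fun y => ‖y‖ := by
    simpa [hcrit] using hA'.isLittleO.norm_right
  obtain ⟨δ, hδ, hdiff⟩ := Metric.eventually_nhds_iff_ball.1
    (eventually_differentiableAt_of_contDiffAt (r := 1) hf)
  have hderiv : ∀ y ∈ Metric.ball (0 : E) δ, HasFDerivWithinAt
      (fun y => f y - (1 / 2) * A y y) (fderiv ℝ f y - A y) (Metric.ball 0 δ) y := fun y hy => by
    refine (((hdiff y hy).hasFDerivAt.sub ((A.hasFDerivAt.clm_apply
      (hasFDerivAt_id y)).const_mul (1 / 2 : ℝ))).congr_fderiv ?_).hasFDerivWithinAt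
    ext v
    simp [hsymm v y]
    ring
  have hball := (convex_ball (0 : E) δ).isLittleO_pow_succ (n := 1) (Metric.mem_ball_self hδ)
    hderiv (by simpa using hlittle.mono nhdsWithin_le_nhds)
  rw [nhdsWithin_eq_nhds.2 (Metric.ball_mem_nhds 0 hδ)] at hball
  simpa [sub_right_comm] using hball

theorem fderiv_fderiv_eq_of_isLittleO {f q : E → ℝ} (hf : ContDiffAt ℝ 2 f 0)
    (hq : ∀ (t : ℝ) z, q (t • z) = t ^ 2 * q z) (hqO : q =O[𝓝 0] fun z => ‖z‖ ^ 2)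
    (h : (fun z => f z - q z) =o[𝓝 0] fun z => ‖z‖ ^ 2) (z : E) :
    (1 / 2) * fderiv ℝ (fderiv ℝ f) 0 z z = q z := by
  have hfO : f =O[𝓝 0] fun z => ‖z - 0‖ ^ 2 := by simpa using h.isBigO.add hqO
  have hf0 : f 0 = 0 := hfO.eq_zero_of_norm_pow two_ne_zero
  have hlittle := (isLittleO_sub_fderiv_fderiv hf (hfO.hasFDerivAt one_lt_two).fderiv).sub h
  simp only [hf0, sub_zero, sub_sub_sub_cancel_left] at hlittle
  refine (sub_eq_zero.1 (eq_zero_of_isLittleO_norm_pow (r := 2) (fun t z => ?_) hlittle z)).symm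
  simp only [map_smul, smul_apply, hq, smul_eq_mul]
  ring

end Order

/-! ### Orders of vanishing of polynomials -/

section PolynomialOrder

theorem eval_smul_of_isHomogeneous {τ R : Type*} [CommSemiring R] {p : MvPolynomial τ R} {r : ℕ}
    (hp : p.IsHomogeneous r) (t : R) (y : τ → R) : eval (t • y) p = t ^ r * eval y p := by
  rw [eval_eq, eval_eq, Finset.mul_sum]
  refine Finset.sum_congr rfl fun s hs => ?_
  have hdeg : ∑ i ∈ s.support, s i = r := by
    rw [← Finsupp.degree_apply, Finsupp.degree_eq_weight_one]
    exact hp (mem_support_iff.1 hs)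
  simp only [Pi.smul_apply, smul_eq_mul, mul_pow, Finset.prod_mul_distrib,
    Finset.prod_pow_eq_pow_sum, hdeg]
  ring

theorem isBigO_eval_zero_left {σ κ : Type*} [Finite σ] [Fintype κ] {p : MvPolynomial (σ ⊕ κ) ℝ}
    {r : ℕ} (hp : p ∈ filtration ℝ parWeight r) :
    (fun z : κ → ℝ => eval (Sum.elim (0 : σ → ℝ) z) p) =O[𝓝 0] fun z => ‖z‖ ^ r := by
  have := Fintype.ofFinite σ
  have hsum : (fun z : κ → ℝ => eval (Sum.elim (0 : σ → ℝ) z) p) = fun z =>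
      ∑ s ∈ p.support, eval (Sum.elim (0 : σ → ℝ) z) (monomial s (coeff s p)) := by
    ext z
    rw [← map_sum, ← p.as_sum]
  rw [hsum]
  refine IsBigO.fun_sum fun s hs => ?_
  have hw : r ≤ 2 * ∑ i, s (Sum.inl i) + ∑ j, s (Sum.inr j) :=
    (hp hs : r ≤ _).trans_eq (weight_parWeight s)
  have hbound := fun z : κ → ℝ => norm_eval_monomial_le s (coeff s p) 0 z
  by_cases hpar : ∑ i, s (Sum.inl i) = 0
  · rw [hpar, mul_zero, zero_add] at hw
    refine (IsBigO.of_bound ‖coeff s p‖ (Eventually.of_forall fun z => ?_)).trans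
      (norm_pow_isBigO_norm_pow hw)
    simpa [hpar] using hbound z
  · refine (isBigO_zero _ _).congr_left fun z => ?_
    exact Eq.symm (by simpa [hpar] using hbound z)

variable {σ κ : Type*} [Fintype σ] [Fintype κ] {p : MvPolynomial (σ ⊕ κ) ℝ} {r : ℕ}

theorem isBigO_eval_of_mem_filtration_one (hp : p ∈ filtration ℝ 1 r) :
    (fun y : (σ → ℝ) × (κ → ℝ) => eval (Sum.elim y.1 y.2) p) =O[𝓝 0] fun y => ‖y‖ ^ r := by
  simpa only [pow_zero, one_mul] using
    isBigO_eval (i := 0) (mem_filtration_zero _ _) ((zero_add r).symm ▸ hp)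

theorem mem_filtration_one_of_isBigO
    (h : (fun y : (σ → ℝ) × (κ → ℝ) => eval (Sum.elim y.1 y.2) p) =O[𝓝 0] fun y => ‖y‖ ^ r) :
    p ∈ filtration ℝ 1 r := by
  induction r with
  | zero => exact mem_filtration_zero _ _
  | succ r ih =>
    set c := weightedHomogeneousComponent 1 r p
    have hpc : p - c ∈ filtration ℝ 1 (r + 1) := sub_weightedHomogeneousComponent_mem_filtration
      (ih (h.trans (norm_pow_isBigO_norm_pow r.le_succ)))
    have hc : (fun y : (σ → ℝ) × (κ → ℝ) => eval (Sum.elim y.1 y.2) c) =O[𝓝 0]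
        fun y => ‖y‖ ^ (r + 1) := by
      simpa using h.sub (isBigO_eval_of_mem_filtration_one hpc)
    have hhom : ∀ (t : ℝ) (y : (σ → ℝ) × (κ → ℝ)),
        eval (Sum.elim (t • y).1 (t • y).2) c = t ^ r • eval (Sum.elim y.1 y.2) c := fun t y => by
      rw [smul_eq_mul, ← eval_smul_of_isHomogeneous
        (weightedHomogeneousComponent_isWeightedHomogeneous r p) t (Sum.elim y.1 y.2)]
      congr 2
      ext (i | j) <;> rfl
    have hc0 : c = 0 := MvPolynomial.funext fun y => by
      simpa using eq_zero_of_isLittleO_norm_pow hhom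
        (hc.trans_isLittleO (norm_pow_isLittleO_norm_pow r.lt_succ_self))
        (y ∘ Sum.inl, y ∘ Sum.inr)
    simpa only [hc0, sub_zero] using hpc

end PolynomialOrder

/-! ### The linear part of the vector field -/

section Linearisation

theorem fderiv_fderiv_eq_dotProduct {κ : Type*} [Fintype κ] {B : Matrix κ κ ℝ} (hB : B.IsSymm)
    {f : (κ → ℝ) → ℝ} (hf : ContDiffAt ℝ 2 f 0)
    (h : ∀ z, (1 / 2) * fderiv ℝ (fderiv ℝ f) 0 z z = (1 / 2) * (z ⬝ᵥ B *ᵥ z)) (u v : κ → ℝ) :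
    fderiv ℝ (fderiv ℝ f) 0 u v = u ⬝ᵥ B *ᵥ v := by
  have hsymm : fderiv ℝ (fderiv ℝ f) 0 u v = fderiv ℝ (fderiv ℝ f) 0 v u :=
    hf.isSymmSndFDerivAt (by simp) u v
  have hsymm' : v ⬝ᵥ B *ᵥ u = u ⬝ᵥ B *ᵥ v := by
    rw [Matrix.dotProduct_mulVec, ← Matrix.mulVec_transpose, hB.eq, dotProduct_comm]
  have huv := h (u + v)
  simp only [map_add, add_apply, Matrix.mulVec_add, dotProduct_add, add_dotProduct] at huv
  linarith [h u, h v]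

variable {m n : ℕ}

theorem hasFDerivAt_partialD {K : Phase n → ℝ} (hK : ContDiffAt ℝ 2 K 0) (j : Fin n ⊕ Fin n) :
    HasFDerivAt (partialD K j)
      ((ContinuousLinearMap.apply ℝ ℝ (Pi.single j 1)).comp (fderiv ℝ (fderiv ℝ K) 0)) 0 :=
  (ContinuousLinearMap.apply ℝ ℝ (Pi.single j 1 : Phase n)).hasFDerivAt.comp 0
    ((hK.fderiv_right (m := 1) (by norm_num)).differentiableAt one_ne_zero).hasFDerivAt

theorem linearisation_eq_hamMat {B : Matrix (Fin n ⊕ Fin n) (Fin n ⊕ Fin n) ℝ} (hB : B.IsSymm)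
    {K : Phase n → ℝ} (hK : ContDiffAt ℝ 2 K 0)
    (h : ∀ z, quadraticPart K z = (1 / 2) * (z ⬝ᵥ B *ᵥ z)) : linearisation K = hamMat B := by
  have hentry : ∀ i j, fderiv ℝ (fderiv ℝ K) 0 (Pi.single j 1) (Pi.single i 1) = B i j :=
    fun i j => by
      rw [fderiv_fderiv_eq_dotProduct hB hK h, Matrix.mulVec_single_one, single_one_dotProduct]
      exact hB.apply i j
  have hV : HasFDerivAt (hamVF K) (ContinuousLinearMap.pi (Sum.elim
      (fun i => (ContinuousLinearMap.apply ℝ ℝ (Pi.single (Sum.inr i) 1)).comp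
        (fderiv ℝ (fderiv ℝ K) 0))
      fun i => -(ContinuousLinearMap.apply ℝ ℝ (Pi.single (Sum.inl i) 1)).comp
        (fderiv ℝ (fderiv ℝ K) 0))) 0 := by
    rw [hasFDerivAt_pi]
    rintro (i | i)
    · exact hasFDerivAt_partialD hK (Sum.inr i)
    · exact (hasFDerivAt_partialD hK (Sum.inl i)).neg
  ext i j
  rw [linearisation, hV.fderiv, LinearMap.toMatrix'_apply]
  rcases i with i | i <;> simp [hamMat, symp, hentry]

theorem hasFDerivAt_eval {τ : Type*} [Fintype τ] (p : MvPolynomial τ ℝ) (y : τ → ℝ) :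
    HasFDerivAt (fun y => eval y p)
      (∑ i, eval y (pderiv i p) • (ContinuousLinearMap.proj i : (τ → ℝ) →L[ℝ] ℝ)) y := by
  classical
  induction p using MvPolynomial.induction_on with
  | C c => simpa using hasFDerivAt_const c y
  | add p q hp hq =>
    simp only [map_add, add_smul, Finset.sum_add_distrib]
    exact hp.add hq
  | mul_X p i hp =>
    simp only [map_mul, eval_X]
    refine (hp.mul (hasFDerivAt_apply (𝕜 := ℝ) (F' := fun _ : τ => ℝ) i y)).congr_fderiv ?_
    have hpderiv : ∀ j, eval y (pderiv j (p * X i)) =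
        eval y p * Pi.single (M := fun _ => ℝ) i 1 j + y i * eval y (pderiv j p) := fun j => by
      rw [Derivation.leibniz, pderiv_X, smul_eq_mul, smul_eq_mul, map_add, map_mul, map_mul,
        eval_X]
      rcases eq_or_ne j i with rfl | hij <;> simp [*]
    simp only [hpderiv, add_smul, Finset.sum_add_distrib, mul_smul, ← Finset.smul_sum]
    congr 2
    ext v
    simp [Pi.single_apply]

/-- The identification of pairs `(ε, z)` with families indexed by a sum type. -/
def elimCLE (σ κ : Type*) : ((σ → ℝ) × (κ → ℝ)) ≃L[ℝ] (σ ⊕ κ → ℝ) :=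
  (ContinuousLinearEquiv.sumPiEquivProdPi ℝ σ κ fun _ => ℝ).symm

theorem elimCLE_apply {σ κ : Type*} (ε : σ → ℝ) (z : κ → ℝ) :
    elimCLE σ κ (ε, z) = Sum.elim ε z := rfl

theorem hasFDerivAt_evalAt (P : PolyHam m n) (ε : Param m) (z : Phase n) :
    HasFDerivAt (evalAt P ε) (∑ j, eval (Sum.elim ε z) (pderiv (Sum.inr j) P) •
      (ContinuousLinearMap.proj j : Phase n →L[ℝ] ℝ)) z := by
  refine (((hasFDerivAt_eval P (elimCLE _ _ (ε, z))).comp (ε, z)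
    (elimCLE (Fin m) (Fin n ⊕ Fin n)).hasFDerivAt).comp z
    (hasFDerivAt_prodMk_right ε z)).congr_fderiv ?_
  ext v
  simp [Fintype.sum_sum_type, elimCLE_apply]

theorem elphickInvariant_of_derivAlong {L : Matrix (Fin n ⊕ Fin n) (Fin n ⊕ Fin n) ℝ}
    {P : PolyHam m n} (h : derivAlong Lᵀ P = 0) : ElphickInvariant L P := by
  intro ε z
  have heval := congrArg (eval (Sum.elim ε z)) h
  rw [derivAlong_apply] at heval
  simp only [map_sum, smul_eval, map_mul, eval_X, Sum.elim_inr, map_zero] at heval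
  rw [(hasFDerivAt_evalAt P ε z).fderiv, ← heval]
  simp only [sum_apply, smul_apply, ContinuousLinearMap.proj_apply, smul_eq_mul, Matrix.mulVec,
    dotProduct, Finset.mul_sum]
  exact Finset.sum_congr rfl fun i _ => Finset.sum_congr rfl fun j _ => by ring

end Linearisation

/-! ### Taylor polynomials of a family of Hamiltonians -/

section Taylor

variable {σ κ : Type*} {f : (σ → ℝ) × (κ → ℝ) → ℝ} {k : ℕ}

theorem tendsto_elim :
    Tendsto (fun y : (σ → ℝ) × (κ → ℝ) => (Sum.elim y.1 y.2 : σ ⊕ κ → ℝ)) (𝓝 0) (𝓝 0) :=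
  (elimCLE σ κ).continuous.tendsto' 0 0 (map_zero _)

theorem fderiv_comp_elimCLE_symm [Finite σ] [Finite κ] [DecidableEq σ] [DecidableEq κ]
    {ε : σ → ℝ} {z : κ → ℝ}
    (hf : DifferentiableAt ℝ (fun y => f ((elimCLE σ κ).symm y)) (Sum.elim ε z)) (j : κ) :
    fderiv ℝ (fun y => f ((elimCLE σ κ).symm y)) (Sum.elim ε z) (Pi.single (Sum.inr j) 1) =
      fderiv ℝ (fun z => f (ε, z)) z (Pi.single j 1) := by
  have := Fintype.ofFinite σ
  have := Fintype.ofFinite κ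
  have hcomp := (HasFDerivAt.comp (ε, z) (f := elimCLE σ κ) hf.hasFDerivAt
    (elimCLE σ κ).hasFDerivAt).comp z (hasFDerivAt_prodMk_right ε z)
  have hsection : HasFDerivAt (fun z => f (ε, z)) _ z := hcomp
  rw [hsection.fderiv]
  simp only [ContinuousLinearMap.comp_apply]
  congr 1
  ext (i | i) <;> simp [elimCLE_apply, Pi.single_apply]

theorem vanishesToOrder_two [Finite σ] [Fintype κ] [DecidableEq σ] [DecidableEq κ]
    (hf : ∀ᶠ y in 𝓝 0, DifferentiableAt ℝ (fun y => f ((elimCLE σ κ).symm y)) y)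
    (hzero : ∀ᶠ ε in 𝓝 0, f (ε, 0) = 0)
    (hcrit : ∀ᶠ ε in 𝓝 0, fderiv ℝ (fun z => f (ε, z)) 0 = 0) :
    VanishesToOrder phaseVars 2 fun y => f ((elimCLE σ κ).symm y) := by
  have := Fintype.ofFinite σ
  have hray : ∀ y : σ ⊕ κ → ℝ, rayPt phaseVars 0 y = Sum.elim (fun i => y (Sum.inl i)) 0 :=
    fun y => by ext (i | i) <;> simp [rayPt, phaseVars]
  have hpar : Tendsto (fun (y : σ ⊕ κ → ℝ) i => y (Sum.inl i)) (𝓝 0) (𝓝 0) :=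
    (show Continuous fun (y : σ ⊕ κ → ℝ) i => y (Sum.inl i) by fun_prop).tendsto 0
  have htendsto : Tendsto (rayPt (phaseVars : Finset (σ ⊕ κ)) 0) (𝓝 0) (𝓝 0) :=
    squeeze_zero_norm (norm_rayPt_le _ (by simp)) tendsto_norm_zero
  refine ⟨?_, fun i hi => ⟨?_, fun _ _ => trivial⟩⟩
  · filter_upwards [hpar.eventually hzero] with y hy
    rw [hray]
    exact hy
  · obtain ⟨j, -, rfl⟩ := Finset.mem_map.1 hi
    filter_upwards [htendsto.eventually hf, hpar.eventually hcrit] with y hdiff hy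
    rw [hray] at hdiff ⊢
    rw [Function.Embedding.inr_apply, fderiv_comp_elimCLE_symm hdiff, hy, zero_apply]

variable [Fintype σ] [Fintype κ]

theorem norm_elim (y : (σ → ℝ) × (κ → ℝ)) : ‖(Sum.elim y.1 y.2 : σ ⊕ κ → ℝ)‖ = ‖y‖ := by
  apply le_antisymm
  · refine (pi_norm_le_iff_of_nonneg (norm_nonneg _)).2 ?_
    rintro (i | j)
    · exact (norm_le_pi_norm y.1 i).trans (norm_fst_le y)
    · exact (norm_le_pi_norm y.2 j).trans (norm_snd_le y)
  · refine max_le ?_ ?_ <;> refine (pi_norm_le_iff_of_nonneg (norm_nonneg _)).2 fun i => ?_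
    · exact norm_le_pi_norm (Sum.elim y.1 y.2 : σ ⊕ κ → ℝ) (Sum.inl i)
    · exact norm_le_pi_norm (Sum.elim y.1 y.2 : σ ⊕ κ → ℝ) (Sum.inr i)

theorem contDiffAt_comp_elimCLE_symm (hf : ContDiffAt ℝ (k : WithTop ℕ∞) f 0) :
    ContDiffAt ℝ (k : WithTop ℕ∞) (fun y => f ((elimCLE σ κ).symm y)) 0 :=
  ContDiffAt.comp 0 ((map_zero (elimCLE σ κ).symm).symm ▸ hf)
    (elimCLE σ κ).symm.contDiff.contDiffAt

theorem exists_eval_elim_sub_isBigO (hf : ContDiffAt ℝ (k : WithTop ℕ∞) f 0) :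
    ∃ p, (fun y => f y - eval (Sum.elim y.1 y.2) p) =O[𝓝 0] fun y => ‖y‖ ^ k := by
  obtain ⟨p, hp⟩ := exists_eval_sub_isBigO_norm_pow k (contDiffAt_comp_elimCLE_symm hf)
  refine ⟨p, (hp.comp_tendsto tendsto_elim).congr (fun y => rfl) fun y => ?_⟩
  rw [Function.comp_apply, norm_elim]

theorem exists_eval_elim_sub_isBigO_of_fderiv_eq_zero
    (hf : ContDiffAt ℝ ((k + 2 : ℕ) : WithTop ℕ∞) f 0)
    (hzero : ∀ᶠ ε in 𝓝 0, f (ε, 0) = 0)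
    (hcrit : ∀ᶠ ε in 𝓝 0, fderiv ℝ (fun z => f (ε, z)) 0 = 0) :
    ∃ p ∈ filtration ℝ phaseWeight 2, (fun y => f y - eval (Sum.elim y.1 y.2) p) =O[𝓝 0]
      fun y => ‖y.2‖ ^ 2 * ‖y‖ ^ k := by
  classical
  have hsmooth := contDiffAt_comp_elimCLE_symm hf
  have hwt : ∀ i ∈ (phaseVars : Finset (σ ⊕ κ)), phaseWeight i = 1 := by
    simp [phaseVars, phaseWeight]
  obtain ⟨p, hp, hO⟩ := exists_eval_sub_isBigO_of_vanishesToOrder hwt k 2 hsmooth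
    (vanishesToOrder_two (eventually_differentiableAt_of_contDiffAt (r := k + 1) hsmooth)
      hzero hcrit)
  refine ⟨p, hp, (hO.comp_tendsto tendsto_elim).congr (fun y => rfl) fun y => ?_⟩
  simp only [Function.comp_apply, norm_elim, norm_part_phaseVars, Sum.elim_inr]

theorem norm_snd_pow_mul_norm_pow_isBigO {E F : Type*} [NormedAddCommGroup E]
    [NormedAddCommGroup F] (i j : ℕ) (l : Filter (E × F)) :
    (fun y : E × F => ‖y.2‖ ^ i * ‖y‖ ^ j) =O[l] fun y => ‖y‖ ^ (i + j) := by
  refine IsBigO.of_norm_le fun y => ?_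
  rw [norm_mul, norm_pow, norm_pow, norm_norm, norm_norm, pow_add]
  have := norm_snd_le y
  gcongr

variable {m n : ℕ}

theorem fderiv_eq_zero_of_hamVF_eq_zero {K : Phase n → ℝ} {z : Phase n} (h : hamVF K z = 0) :
    fderiv ℝ K z = 0 := by
  have hpartial : ∀ j, partialD K j z = 0 := by
    rintro (i | i)
    · simpa [hamVF] using congrFun h (Sum.inr i)
    · simpa [hamVF] using congrFun h (Sum.inl i)
  apply ContinuousLinearMap.coe_injective
  ext j
  simpa [partialD] using hpartial j

theorem exists_taylorPolynomial {K : Param m → Phase n → ℝ}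
    (hK : ContDiffAt ℝ ((k + 2 : ℕ) : WithTop ℕ∞) (Function.uncurry K) 0)
    (hO : Function.uncurry K =O[𝓝 0] fun y => ‖y‖ * ‖y.2‖) :
    ∃ p ∈ filtration ℝ 1 2,
      (fun y : Param m × Phase n => K y.1 y.2 - evalAt p y.1 y.2) =O[𝓝 0]
        (fun y => ‖y‖ ^ (k + 2)) ∧
      ((∀ᶠ ε in 𝓝 0, hamVF (K ε) 0 = 0) → p ∈ filtration ℝ phaseWeight 2 ∧
        (fun y : Param m × Phase n => K y.1 y.2 - evalAt p y.1 y.2) =O[𝓝 0]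
          fun y => ‖y.2‖ ^ 2 * ‖y‖ ^ k) := by
  have hO2 : (fun y : Param m × Phase n => K y.1 y.2) =O[𝓝 0] fun y => ‖y‖ ^ 2 := by
    refine hO.trans ?_
    simpa [mul_comm] using norm_snd_pow_mul_norm_pow_isBigO 1 1 (𝓝 (0 : Param m × Phase n))
  have hmem : ∀ p : PolyHam m n,
      (fun y : Param m × Phase n => K y.1 y.2 - evalAt p y.1 y.2) =O[𝓝 0]
        (fun y => ‖y‖ ^ (k + 2)) → p ∈ filtration ℝ 1 2 := fun p hp => by
    refine mem_filtration_one_of_isBigO ?_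
    simpa [evalAt] using hO2.sub (hp.trans (norm_pow_isBigO_norm_pow (by omega)))
  by_cases heq : ∀ᶠ ε in 𝓝 0, hamVF (K ε) 0 = 0
  · have hzero : ∀ᶠ ε in 𝓝 0, Function.uncurry K (ε, 0) = 0 := by
      obtain ⟨c, hc⟩ := hO.bound
      have hpar : Tendsto (fun ε : Param m => (ε, (0 : Phase n))) (𝓝 0) (𝓝 0) :=
        (show Continuous fun ε : Param m => (ε, (0 : Phase n)) by fun_prop).tendsto 0
      filter_upwards [hpar.eventually hc] with ε hε
      simpa using hε
    obtain ⟨p, hp, hpO⟩ := exists_eval_elim_sub_isBigO_of_fderiv_eq_zero hK hzero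
      (heq.mono fun ε hε => fderiv_eq_zero_of_hamVF_eq_zero hε)
    have hpO' := hpO.trans (norm_snd_pow_mul_norm_pow_isBigO 2 k _)
    rw [add_comm 2 k] at hpO'
    exact ⟨p, hmem p hpO', hpO', fun _ => ⟨hp, hpO⟩⟩
  · obtain ⟨p, hp⟩ := exists_eval_elim_sub_isBigO hK
    exact ⟨p, hmem p hp, hp, fun h => absurd h heq⟩

end Taylor

/-! ### The normal form of the lower-order Hamiltonian -/

section LowerOrder

variable {m n k : ℕ} {H : Param m → Phase (n + 1) → ℝ}

theorem contDiff_extend : ContDiff ℝ ∞ (extend : Phase n → Phase (n + 1)) := by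
  rw [contDiff_pi]
  rintro (i | i) <;> refine Fin.cases ?_ (fun i => ?_) i <;>
    simp only [extend_inl_zero, extend_inr_zero, extend_inl_succ, extend_inr_succ] <;> fun_prop

theorem contDiffAt_lowerOrder (hH : ContDiffAt ℝ (k : WithTop ℕ∞) (Function.uncurry H) 0) :
    ContDiffAt ℝ (k : WithTop ℕ∞) (Function.uncurry (lowerOrder H)) 0 := by
  have hext : ContDiff ℝ ∞ fun y : Param m × Phase n => (y.1, extend y.2) :=
    contDiff_fst.prodMk (contDiff_extend.comp contDiff_snd)
  refine ContDiffAt.comp (g := Function.uncurry H) 0 ?_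
    (hext.contDiffAt.of_le (by exact_mod_cast le_top))
  rwa [Prod.fst_zero, Prod.snd_zero, extend_zero]

theorem norm_extend_le (z : Phase n) : ‖extend z‖ ≤ ‖z‖ := by
  refine (pi_norm_le_iff_of_nonneg (norm_nonneg _)).2 ?_
  rintro (i | i) <;> refine Fin.cases ?_ (fun i => ?_) i
  · simp
  · exact norm_le_pi_norm z (Sum.inl i)
  · simp
  · exact norm_le_pi_norm z (Sum.inr i)

theorem lowerOrder_isBigO
    (hH : (fun y : Param m × Phase (n + 1) => H y.1 y.2) =O[𝓝 0]
      fun y => ‖(y.1, dropP0 y.2)‖ * ‖dropP0 y.2‖) :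
    Function.uncurry (lowerOrder H) =O[𝓝 0] fun y => ‖y‖ * ‖y.2‖ := by
  have htendsto : Tendsto (fun y : Param m × Phase n => (y.1, extend y.2)) (𝓝 0) (𝓝 0) :=
    (continuous_fst.prodMk (contDiff_extend.continuous.comp continuous_snd)).tendsto' 0 0
      (Prod.ext rfl extend_zero)
  refine (hH.comp_tendsto htendsto).trans (IsBigO.of_norm_le fun y => ?_)
  have hsnd : ‖dropP0 (extend y.2)‖ ≤ ‖y.2‖ := (norm_dropP0_le _).trans (norm_extend_le _)
  have hprod : ‖(y.1, dropP0 (extend y.2))‖ ≤ ‖y‖ := max_le_max le_rfl hsnd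
  simp only [Function.comp_apply, norm_mul, norm_norm]
  gcongr

end LowerOrder

section Transform

variable {m n k : ℕ} {H : Param m → Phase (n + 1) → ℝ}
  {Φ Ψ : Param m → Phase (n + 1) → Phase (n + 1)} {θ : PolyHam m n →ₐ[ℝ] PolyHam m n}

theorem PolyChange.isCanonicalChange (h : PolyChange Φ Ψ θ) : IsCanonicalChange Φ Ψ where
  smooth := Eventually.of_forall fun _ => h.smooth.contDiffAt
  smooth_inv := Eventually.of_forall fun _ => h.smooth_inv.contDiffAt
  left_inv := Eventually.of_forall fun y => h.left_inv y.1 y.2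
  right_inv := Eventually.of_forall fun y => h.right_inv y.1 y.2
  symplectic := Eventually.of_forall fun y => h.symplectic y.1 y.2

theorem PolyChange.inv_apply_zero (h : PolyChange Φ Ψ θ) : Ψ 0 0 = 0 := by
  simpa only [h.apply_zero] using h.left_inv 0 0

theorem PolyChange.tendsto_inv (h : PolyChange Φ Ψ θ) :
    Tendsto (fun y : Param m × Phase (n + 1) => (y.1, Ψ y.1 y.2)) (𝓝 0) (𝓝 0) :=
  (continuous_fst.prodMk h.smooth_inv.continuous).tendsto' 0 0 (Prod.ext rfl h.inv_apply_zero)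

theorem PolyChange.differentiable_inv (h : PolyChange Φ Ψ θ) (ε : Param m) :
    Differentiable ℝ (Ψ ε) :=
  (h.smooth_inv.comp (contDiff_const.prodMk contDiff_id)).differentiable (by simp)

theorem PolyChange.fderiv_inv_single (h : PolyChange Φ Ψ θ) (ε : Param m) (x : Phase (n + 1)) :
    fderiv ℝ (Ψ ε) x (Pi.single (Sum.inr 0) 1) = Pi.single (Sum.inr 0) 1 := by
  have hline : HasDerivAt (fun t : ℝ => Ψ ε (x + t • Pi.single (Sum.inr 0) 1))
      (fderiv ℝ (Ψ ε) x (Pi.single (Sum.inr 0) 1)) 0 :=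
    (h.differentiable_inv ε x).hasFDerivAt.hasLineDerivAt _
  simp only [h.p0] at hline
  refine hline.unique ?_
  simpa using ((hasDerivAt_id (0 : ℝ)).smul_const
    (Pi.single (Sum.inr 0) 1 : Phase (n + 1))).const_add (Ψ ε x)

theorem PolyChange.isCyclicP0 (h : PolyChange Φ Ψ θ) (hcyclic : IsCyclicP0 H)
    (hH : ∀ᶠ y in 𝓝 0, DifferentiableAt ℝ (Function.uncurry H) y) :
    IsCyclicP0 fun ε X => H ε (Ψ ε X) := by
  filter_upwards [h.tendsto_inv.eventually hcyclic, h.tendsto_inv.eventually hH] with y hy hdiff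
  have hsection : DifferentiableAt ℝ (H y.1) (Ψ y.1 y.2) :=
    DifferentiableAt.comp (g := Function.uncurry H) _ hdiff
      ((differentiableAt_const y.1).prodMk differentiableAt_id)
  have hchain : fderiv ℝ (fun X => H y.1 (Ψ y.1 X)) y.2 =
      (fderiv ℝ (H y.1) (Ψ y.1 y.2)).comp (fderiv ℝ (Ψ y.1) y.2) :=
    fderiv_comp y.2 hsection (h.differentiable_inv y.1 y.2)
  rw [partialD, hchain, ContinuousLinearMap.comp_apply, h.fderiv_inv_single]
  exact hy

theorem PolyChange.contDiffAt_comp_inv (h : PolyChange Φ Ψ θ)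
    (hH : ContDiffAt ℝ (k : WithTop ℕ∞) (Function.uncurry H) 0) :
    ContDiffAt ℝ (k : WithTop ℕ∞) (Function.uncurry fun ε X => H ε (Ψ ε X)) 0 := by
  refine ContDiffAt.comp (g := Function.uncurry H) 0 ?_
    ((contDiff_fst.prodMk h.smooth_inv).contDiffAt.of_le (by exact_mod_cast le_top))
  have hzero : ((0 : Param m), Ψ 0 0) = 0 := Prod.ext rfl h.inv_apply_zero
  rw [← hzero] at hH
  exact hH

theorem PolyChange.lowerOrder_comp_inv (h : PolyChange Φ Ψ θ) (ε : Param m) (z : Phase n) :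
    lowerOrder (fun ε X => H ε (Ψ ε X)) ε z = lowerOrder H ε (polyMap θ ε z) :=
  congrArg (H ε) (h.pullback ε z)

theorem PolyChange.prod_polyMap_isBigO (h : PolyChange Φ Ψ θ) :
    (fun y : Param m × Phase n => (y.1, polyMap θ y.1 y.2)) =O[𝓝 0] fun y => ‖y‖ := by
  refine (IsBigO.of_norm_le norm_fst_le).prod_left (isBigO_pi.2 fun j => ?_)
  simpa only [pow_one, polyMap] using isBigO_eval_of_mem_filtration_one (r := 1)
    (h.raises_one.map_mem (X_mem_filtration 1 (Sum.inr j)))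

theorem PreservesEquilibrium.polyMap_isBigO (h : PreservesEquilibrium Φ θ)
    (hθ : PolyChange Φ Ψ θ) :
    (fun y : Param m × Phase n => polyMap θ y.1 y.2) =O[𝓝 0] fun y => ‖y.2‖ := by
  refine isBigO_pi.2 fun j => ?_
  simpa only [pow_one, pow_zero, mul_one, polyMap] using isBigO_eval (i := 1) (j := 0)
    (h.raises_phase.map_mem (X_mem_filtration phaseWeight (Sum.inr j)))
    (hθ.raises_one.map_mem (X_mem_filtration 1 (Sum.inr j)))

theorem PolyChange.tendsto_prod_polyMap (h : PolyChange Φ Ψ θ) :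
    Tendsto (fun y : Param m × Phase n => (y.1, polyMap θ y.1 y.2)) (𝓝 0) (𝓝 0) :=
  h.prod_polyMap_isBigO.trans_tendsto tendsto_norm_zero

theorem PolyChange.isBigO_comp_polyMap (h : PolyChange Φ Ψ θ) {R : Param m × Phase n → ℝ} {r : ℕ}
    (hR : R =O[𝓝 0] fun y => ‖y‖ ^ r) :
    (fun y : Param m × Phase n => R (y.1, polyMap θ y.1 y.2)) =O[𝓝 0] fun y => ‖y‖ ^ r :=
  (hR.comp_tendsto h.tendsto_prod_polyMap).trans (h.prod_polyMap_isBigO.norm_left.pow r)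

theorem PreservesEquilibrium.isBigO_comp_polyMap (h : PreservesEquilibrium Φ θ)
    (hθ : PolyChange Φ Ψ θ) {R : Param m × Phase n → ℝ} {r s : ℕ}
    (hR : R =O[𝓝 0] fun y => ‖y.2‖ ^ r * ‖y‖ ^ s) :
    (fun y : Param m × Phase n => R (y.1, polyMap θ y.1 y.2)) =O[𝓝 0]
      fun y => ‖y.2‖ ^ r * ‖y‖ ^ s :=
  (hR.comp_tendsto hθ.tendsto_prod_polyMap).trans
    (((h.polyMap_isBigO hθ).norm_left.pow r).mul (hθ.prod_polyMap_isBigO.norm_left.pow s))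

theorem PolyChange.lowerOrder_comp_inv_sub (h : PolyChange Φ Ψ θ) (p N : PolyHam m n)
    (B : Matrix (Fin n ⊕ Fin n) (Fin n ⊕ Fin n) ℝ) (ε : Param m) (z : Phase n) :
    lowerOrder (fun ε X => H ε (Ψ ε X)) ε z - (1 / 2) * (z ⬝ᵥ B *ᵥ z) - evalAt N ε z =
      (lowerOrder H ε (polyMap θ ε z) - evalAt p ε (polyMap θ ε z)) +
        evalAt (θ p - quadForm _ B - N) ε z := by
  rw [h.lowerOrder_comp_inv, evalAt, evalAt, evalAt, map_sub, map_sub, h.eval_pullback,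
    eval_quadForm]
  ring

end Transform

section NormalForm

variable {m n k : ℕ} {B : Matrix (Fin n ⊕ Fin n) (Fin n ⊕ Fin n) ℝ} {K : Param m → Phase n → ℝ}
  {N : PolyHam m n}

theorem quadraticPart_isBigO (K : Phase n → ℝ) : quadraticPart K =O[𝓝 0] fun z => ‖z‖ ^ 2 := by
  refine IsBigO.const_mul_left (IsBigO.of_bound ‖fderiv ℝ (fderiv ℝ K) 0‖ ?_) _
  refine Eventually.of_forall fun z => ?_
  rw [norm_pow, norm_norm, pow_two, ← mul_assoc]
  exact (fderiv ℝ (fderiv ℝ K) 0).le_opNorm₂ z z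

theorem dotProduct_mulVec_isBigO {κ : Type*} [Fintype κ] (B : Matrix κ κ ℝ) :
    (fun z : κ → ℝ => z ⬝ᵥ B *ᵥ z) =O[𝓝 0] fun z => ‖z‖ ^ 2 := by
  have happly : ∀ i, (fun z : κ → ℝ => z i) =O[𝓝 0] fun z => ‖z‖ := fun i =>
    IsBigO.of_norm_le fun z => norm_le_pi_norm z i
  simp only [pow_two, dotProduct, Matrix.mulVec]
  exact IsBigO.fun_sum fun i _ => (happly i).mul
    (IsBigO.fun_sum fun j _ => (happly j).const_mul_left _)

theorem quadraticPart_eq (hK : ContDiffAt ℝ 2 (K 0) 0) (hN : N ∈ filtration ℝ parWeight 3)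
    (hrem : (fun y : Param m × Phase n => K y.1 y.2 - (1 / 2) * (y.2 ⬝ᵥ B *ᵥ y.2) -
      evalAt N y.1 y.2) =O[𝓝 0] fun y => ‖y‖ ^ 3) (z : Phase n) :
    quadraticPart (K 0) z = (1 / 2) * (z ⬝ᵥ B *ᵥ z) := by
  have hzero : Tendsto (fun z : Phase n => ((0 : Param m), z)) (𝓝 0) (𝓝 0) :=
    (show Continuous fun z : Phase n => ((0 : Param m), z) by fun_prop).tendsto 0
  have hcubic : (fun z => K 0 z - (1 / 2) * (z ⬝ᵥ B *ᵥ z)) =O[𝓝 0] fun z => ‖z‖ ^ 3 := by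
    have hsection : (fun z => K 0 z - (1 / 2) * (z ⬝ᵥ B *ᵥ z) - evalAt N 0 z) =O[𝓝 0]
        fun z => ‖z‖ ^ 3 := by simpa [Function.comp_def] using hrem.comp_tendsto hzero
    simpa only [evalAt, sub_add_cancel] using hsection.add (isBigO_eval_zero_left hN)
  refine fderiv_fderiv_eq_of_isLittleO (q := fun z => (1 / 2) * (z ⬝ᵥ B *ᵥ z)) hK (fun t z => ?_)
    ((dotProduct_mulVec_isBigO B).const_mul_left _)
    (hcubic.trans_isLittleO (norm_pow_isLittleO_norm_pow (by norm_num))) z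
  simp only [Matrix.mulVec_smul, dotProduct_smul, smul_dotProduct, smul_eq_mul]
  ring

-- For `k = 0` the two quadratic forms may differ, but both are absorbed by the error term.
theorem dotProduct_sub_quadraticPart_isBigO (hK : ContDiffAt ℝ 2 (K 0) 0)
    (hN : N ∈ filtration ℝ parWeight 3)
    (hrem : (fun y : Param m × Phase n => K y.1 y.2 - (1 / 2) * (y.2 ⬝ᵥ B *ᵥ y.2) -
      evalAt N y.1 y.2) =O[𝓝 0] fun y => ‖y‖ ^ (k + 2)) :
    (fun y : Param m × Phase n => (1 / 2) * (y.2 ⬝ᵥ B *ᵥ y.2) - quadraticPart (K 0) y.2) =O[𝓝 0]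
      fun y => ‖y.2‖ ^ 2 * ‖y‖ ^ k := by
  rcases Nat.eq_zero_or_pos k with rfl | hk
  · have hsnd : Tendsto (fun y : Param m × Phase n => y.2) (𝓝 0) (𝓝 0) :=
      continuous_snd.tendsto 0
    simp only [pow_zero, mul_one]
    exact (((dotProduct_mulVec_isBigO B).const_mul_left _).sub
      (quadraticPart_isBigO (K 0))).comp_tendsto hsnd
  · simp only [quadraticPart_eq hK hN (hrem.trans (norm_pow_isBigO_norm_pow (by omega))), sub_self]
    exact isBigO_zero _ _

theorem eq_zero_of_totalDegree_le_one (hdeg : N.totalDegree ≤ 1)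
    (hN : N ∈ filtration ℝ parWeight 3) : N = 0 := by
  by_contra hne
  obtain ⟨s, hs⟩ := support_nonempty.2 hne
  have hs₁ : Finsupp.weight 1 s ≤ 1 := by
    refine le_trans ?_ ((le_totalDegree hs).trans hdeg)
    exact (DFunLike.congr_fun Finsupp.degree_eq_weight_one s).ge
  have hs₃ : 3 ≤ Finsupp.weight parWeight s := hN hs
  rw [weight_one] at hs₁
  rw [weight_parWeight] at hs₃
  omega

theorem elphickInvariant_linearisation (hB : B.IsSymm) (hK : ContDiffAt ℝ 2 (K 0) 0)
    (hdeg : N.totalDegree ≤ k + 1) (hN : N ∈ filtration ℝ parWeight 3)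
    (hNL : derivAlong (hamMat B)ᵀ N = 0)
    (hrem : (fun y : Param m × Phase n => K y.1 y.2 - (1 / 2) * (y.2 ⬝ᵥ B *ᵥ y.2) -
      evalAt N y.1 y.2) =O[𝓝 0] fun y => ‖y‖ ^ (k + 2)) :
    ElphickInvariant (linearisation (K 0)) N := by
  rcases Nat.eq_zero_or_pos k with rfl | hk
  · rw [eq_zero_of_totalDegree_le_one hdeg hN]
    exact elphickInvariant_of_derivAlong (map_zero _)
  · rw [linearisation_eq_hamMat hB hK
      (quadraticPart_eq hK hN (hrem.trans (norm_pow_isBigO_norm_pow (by omega))))]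
    exact elphickInvariant_of_derivAlong hNL

theorem inNormalForm_of_isBigO (hB : B.IsSymm) (hK : ContDiffAt ℝ 2 (K 0) 0)
    (hdeg : N.totalDegree ≤ k + 1) (hN : N ∈ filtration ℝ parWeight 3)
    (hNL : derivAlong (hamMat B)ᵀ N = 0)
    (hrem : (fun y : Param m × Phase n => K y.1 y.2 - (1 / 2) * (y.2 ⬝ᵥ B *ᵥ y.2) -
      evalAt N y.1 y.2) =O[𝓝 0] fun y => ‖y‖ ^ (k + 2)) :
    InNormalForm k K N := by
  refine ⟨hdeg, elphickInvariant_linearisation hB hK hdeg hN hNL hrem,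
    isBigO_eval_of_mem_filtration_one fun s hs => ?_, isBigO_eval_zero_left hN, ?_⟩
  · have hs₃ : 3 ≤ Finsupp.weight parWeight s := hN hs
    rw [weight_parWeight] at hs₃
    rw [Set.mem_ofPred_eq, weight_one]
    omega
  · have hquad := (dotProduct_sub_quadraticPart_isBigO hK hN hrem).trans
      (norm_snd_pow_mul_norm_pow_isBigO 2 k _)
    rw [add_comm 2 k] at hquad
    refine (hrem.add hquad).congr_left fun y => ?_
    ring

theorem evalAt_isBigO_of_mem_filtration (hN : N ∈ filtration ℝ parWeight 3)
    (hN₂ : N ∈ filtration ℝ phaseWeight 2) :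
    (fun y : Param m × Phase n => evalAt N y.1 y.2) =O[𝓝 0] fun y => ‖y.2‖ ^ 2 * ‖y‖ := by
  simpa only [pow_one, evalAt] using isBigO_eval (j := 1) hN₂ fun s hs => by
    have hs₃ : 3 ≤ Finsupp.weight parWeight s := hN hs
    have hs₂ : 2 ≤ Finsupp.weight phaseWeight s := hN₂ hs
    rw [weight_parWeight] at hs₃
    rw [weight_phaseWeight] at hs₂
    rw [Set.mem_ofPred_eq, weight_one]
    omega

theorem exists_polyChange_inNormalForm {H : Param m → Phase (n + 1) → ℝ}
    (hsmooth : ContDiffAt ℝ ((k + 2 : ℕ) : WithTop ℕ∞) (Function.uncurry H) 0)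
    (hH : (fun y : Param m × Phase (n + 1) => H y.1 y.2) =O[𝓝 0]
      fun y => ‖(y.1, dropP0 y.2)‖ * ‖dropP0 y.2‖) :
    ∃ (Φ Ψ : Param m → Phase (n + 1) → Phase (n + 1)) (θ : PolyHam m n →ₐ[ℝ] PolyHam m n)
      (N : PolyHam m n), PolyChange Φ Ψ θ ∧
      InNormalForm k (lowerOrder fun ε X => H ε (Ψ ε X)) N ∧
      ((∀ᶠ ε in 𝓝 0, hamVF (lowerOrder H ε) 0 = 0) → PreservesEquilibrium Φ θ ∧
        (fun y : Param m × Phase n => evalAt N y.1 y.2) =O[𝓝 0] (fun y => ‖y.2‖ ^ 2 * ‖y‖) ∧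
        (fun y : Param m × Phase n => lowerOrder (fun ε X => H ε (Ψ ε X)) y.1 y.2 -
            quadraticPart (lowerOrder (fun ε X => H ε (Ψ ε X)) 0) y.2 - evalAt N y.1 y.2) =O[𝓝 0]
          fun y => ‖y.2‖ ^ 2 * ‖y‖ ^ k) := by
  obtain ⟨p, hp, htaylor, hequilibrium⟩ :=
    exists_taylorPolynomial (contDiffAt_lowerOrder hsmooth) (lowerOrder_isBigO hH)
  obtain ⟨B, hB, hpB⟩ := exists_sub_quadForm_mem_filtration hp
  obtain ⟨Φ, Ψ, θ, N, hθ, hdeg, hN, hNL, hpoly, hphase⟩ :=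
    exists_polyChange_sub_mem_filtration_one hB hpB k
  set K := lowerOrder fun ε X => H ε (Ψ ε X)
  have hK : ContDiffAt ℝ 2 (K 0) 0 :=
    ((contDiffAt_lowerOrder (hθ.contDiffAt_comp_inv hsmooth)).comp (0 : Phase n)
      (contDiffAt_const.prodMk contDiffAt_id)).of_le (by norm_cast; omega)
  have hrem : (fun y : Param m × Phase n => K y.1 y.2 - (1 / 2) * (y.2 ⬝ᵥ B *ᵥ y.2) -
      evalAt N y.1 y.2) =O[𝓝 0] fun y => ‖y‖ ^ (k + 2) :=
    ((hθ.isBigO_comp_polyMap htaylor).add (isBigO_eval_of_mem_filtration_one hpoly)).congr_left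
      fun y => (hθ.lowerOrder_comp_inv_sub p N B y.1 y.2).symm
  refine ⟨Φ, Ψ, θ, N, hθ, inNormalForm_of_isBigO hB hK hdeg hN hNL hrem, fun hcrit => ?_⟩
  obtain ⟨hp₂, htaylor₂⟩ := hequilibrium hcrit
  obtain ⟨hΦ, hN₂⟩ := hphase hp₂
  refine ⟨hΦ, evalAt_isBigO_of_mem_filtration hN hN₂, ?_⟩
  have hpoly₂ : (fun y : Param m × Phase n => evalAt (θ p - quadForm _ B - N) y.1 y.2) =O[𝓝 0]
      fun y => ‖y.2‖ ^ 2 * ‖y‖ ^ k :=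
    isBigO_eval (sub_mem (sub_mem (hΦ.raises_phase.map_mem hp₂)
      (quadForm_mem_filtration_phaseWeight B)) hN₂) (by rwa [add_comm 2 k])
  refine (((hΦ.isBigO_comp_polyMap hθ htaylor₂).add hpoly₂).add
    (dotProduct_sub_quadraticPart_isBigO hK hN hrem)).congr_left fun y => ?_
  rw [← hθ.lowerOrder_comp_inv_sub p N B y.1 y.2]
  ring

end NormalForm

end HamNF

theorem mainTheorem4 (m n k : ℕ) (H : HamNF.Param m → HamNF.Phase (n + 1) → ℝ)
    (hsmooth : ContDiffAt ℝ ((k + 2 : ℕ) : WithTop ℕ∞) (Function.uncurry H) 0)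
    (hcyclic : HamNF.IsCyclicP0 H)
    (hH : (fun y : HamNF.Param m × HamNF.Phase (n + 1) => H y.1 y.2) =O[𝓝 0]
      (fun y => ‖(y.1, HamNF.dropP0 y.2)‖ * ‖HamNF.dropP0 y.2‖)) :
    ∃ (Φ Ψ : HamNF.Param m → HamNF.Phase (n + 1) → HamNF.Phase (n + 1))
      (P : MvPolynomial (Fin m ⊕ (Fin n ⊕ Fin n)) ℝ),
      HamNF.IsCanonicalChange Φ Ψ ∧
      HamNF.IsNearIdentity Φ ∧
      -- `Q_0 = q_0`
      (∀ᶠ y : HamNF.Param m × HamNF.Phase (n + 1) in 𝓝 0,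
        Φ y.1 y.2 (Sum.inl 0) = y.2 (Sum.inl 0)) ∧
      -- `P_0` is cyclic for the transformed Hamiltonian
      HamNF.IsCyclicP0 (fun ε X => H ε (Ψ ε X)) ∧
      -- the transformed lower-order system is in normal form
      HamNF.InNormalForm k (HamNF.lowerOrder fun ε X => H ε (Ψ ε X)) P ∧
      -- sharper estimates if the origin is an equilibrium of the lower-order system for small `ε`
      ((∀ᶠ ε : HamNF.Param m in 𝓝 0, HamNF.hamVF (HamNF.lowerOrder H ε) 0 = 0) →
        ((fun y : HamNF.Param m × HamNF.Phase (n + 1) => Φ y.1 y.2 - y.2) =O[𝓝 0]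
          (fun y => ‖(y.1, HamNF.dropP0 y.2)‖ * ‖HamNF.restrict y.2‖)) ∧
        ((fun y : HamNF.Param m × HamNF.Phase n => HamNF.evalAt P y.1 y.2) =O[𝓝 0]
          (fun y => ‖y.2‖ ^ 2 * ‖y‖)) ∧
        ((fun y : HamNF.Param m × HamNF.Phase n =>
            HamNF.lowerOrder (fun ε X => H ε (Ψ ε X)) y.1 y.2
              - HamNF.quadraticPart (HamNF.lowerOrder (fun ε X => H ε (Ψ ε X)) 0) y.2
              - HamNF.evalAt P y.1 y.2) =O[𝓝 0]
          (fun y => ‖y.2‖ ^ 2 * ‖y‖ ^ k))) := by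
  obtain ⟨Φ, Ψ, θ, P, hθ, hnormal, hequilibrium⟩ :=
    HamNF.exists_polyChange_inNormalForm hsmooth hH
  have hdiff : ∀ᶠ y in 𝓝 0, DifferentiableAt ℝ (Function.uncurry H) y :=
    HamNF.eventually_differentiableAt_of_contDiffAt (r := k + 1) hsmooth
  exact ⟨Φ, Ψ, P, hθ.isCanonicalChange, ⟨hθ.apply_zero, hθ.hasFDerivAt_zero.fderiv⟩,
    Eventually.of_forall fun y => hθ.q0 y.1 y.2, hθ.isCyclicP0 hcyclic hdiff, hnormal,
    fun hcrit => (hequilibrium hcrit).imp_left fun hΦ => hΦ.sub_isBigO⟩
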